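/- Let $\mathbb F$ be a binary floating-point format of precision $p$ and maximal exponent $e_{\max}$ with $2\le p\le e_{\max}$ (this covers all IEEE 754 binary formats), including subnormal numbers, signed zeros, $\pm\infty$ and NaN, with correctly rounded IEEE 754 operations in the standard rounding modes. Let $n\ge 1$, let $A\in\mathbb F^{n\times n}$ and $\widetilde R\in\mathbb F^{n\times n}$ have finite entries, and let $\widetilde R$ be upper triangular with no negative diagonal entry. Consider the following algorithm. "Enclosing" or "bounding" an expression means evaluating it in $\mathbb F$ with directed rounding (downwards for lower bounds, upwards for upper bounds), $\|\cdot\|$ is the infinity norm, $\mathrm{triu}$ is the upper triangular part, and $\mathbf 1$ is the all-ones column vector. 1. Compute an approximate inverse $V$ of $\widetilde R$, upper triangular, by back substitution in $\mathbb F$ (in any one rounding mode). Enclose $W=\widetilde RV$ in an interval matrix $[\underline W,\overline W]$, bound $|W-I|$, compute an upper bound $w$ on $\|W-I\|$, and test whether $w<1$. 2. Compute $U$ as an upward-rounded evaluation of the bound $|2I-W|+\frac{w^2}{1-w}\,\mathrm{triu}(\mathbf 1\mathbf 1^T)$ on $|W^{-1}|$. 3. Enclose $B=AV$ in an interval matrix,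 and compute a bound $S$ on $|B^TB-I|+|W^TW-I|$. Here, for $M\in[\underline M,\overline M]$, $|M^TM-I|$ is bounded with the midpoint $m$ (an upward rounding of $(\underline M+\overline M)/2$) and the radius $r$ (an upward rounding of $m-\underline M$) by a bound on $|m^Tm-I|$ plus $|m|^Tr+r^T(|m|+r)$. 4. Compute a bound $\widehat G$ on $U^TSU$ (hence on $G=|\widetilde R^{-T}A^TA\widetilde R^{-1}-I|$), computing the upper triangle and copying it by symmetry, and an upper bound $g$ on $\|\widehat G\|$, and test whether $g<1$. 5. Compute a bound $H$ on $\mathrm{triu}(\widehat G)+\frac{g^2}{1-g}\,\mathrm{triu}(\mathbf 1\mathbf 1^T)$ and an upward-rounded evaluation of the product $H|\widetilde R|$. Return that matrix as $F$ if both tests succeeded; otherwise return the matrix $F$ with all entries $+\infty$. All matrix products are evaluated by the usual sums of products, restricted to the indices and entries that triangularity and symmetry leave. Then the matrix $F$ satisfies $|\widetilde R-R|\le F$ componentwise (an entry $+\infty$ bounds everything, a NaN bounds nothing), where $R$ is the exact $QR$ factor of $A$: $A=QR$ with $Q$ orthogonal and $R$ upper triangular with positive diagonal (it exists when $A$ is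 invertible). The number $T$ of floating-point operations (additions, subtractions, multiplications, divisions, negations, absolute values, maxima, comparisons) is $10n^3+O(n^2)$: there is an absolute constant $C$, independent of the format, the rounding mode used for $V$, $n$, $A$ and $\widetilde R$, with $|T-10n^3|\le Cn^2$. -/

import Mathlib

noncomputable section

namespace CertQR

/-! ### Binary floating point data and IEEE 754 arithmetic -/

/-- A binary floating point format: precision `prec` and exponents between `1 - emax` and `emax`.
All IEEE 754 binary formats (single: `24, 127`; double: `53, 1023`) satisfy the two inequalities. -/
structure Format where
  prec : ℕ
  emax : ℕ
  two_le_prec : 2 ≤ prec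
  prec_le_emax : prec ≤ emax

/-- The smallest exponent of a normal number. -/
def Format.emin (fmt : Format) : ℤ := 1 - (fmt.emax : ℤ)

/-- The finite numbers of the format (normal numbers, subnormal numbers and zero), as reals. -/
def Format.IsRep (fmt : Format) (x : ℝ) : Prop :=
  ∃ m e : ℤ, |m| < 2 ^ fmt.prec ∧ fmt.emin ≤ e ∧ e ≤ (fmt.emax : ℤ) ∧
    x = (m : ℝ) * (2 : ℝ) ^ (e - ((fmt.prec : ℤ) - 1))

/-- The numbers of the format whose last significand bit is zero; the significand is the
normalized one, except for subnormal numbers. -/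
def Format.IsEven (fmt : Format) (x : ℝ) : Prop :=
  ∃ m e : ℤ, Even m ∧ |m| < 2 ^ fmt.prec ∧ fmt.emin ≤ e ∧ e ≤ (fmt.emax : ℤ) ∧
    (2 ^ (fmt.prec - 1) ≤ |m| ∨ e = fmt.emin) ∧
    x = (m : ℝ) * (2 : ℝ) ^ (e - ((fmt.prec : ℤ) - 1))

theorem Format.finite_rep (fmt : Format) : {x : ℝ | fmt.IsRep x}.Finite := by
  refine (((Set.finite_Icc (-(2 : ℤ) ^ fmt.prec) (2 ^ fmt.prec)).prod
    (Set.finite_Icc fmt.emin (fmt.emax : ℤ))).image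
    (fun q : ℤ × ℤ => (q.1 : ℝ) * (2 : ℝ) ^ (q.2 - ((fmt.prec : ℤ) - 1)))).subset ?_
  rintro x ⟨m, e, hm, he, he', rfl⟩
  have := abs_lt.mp hm
  exact ⟨(m, e), ⟨⟨this.1.le, this.2.le⟩, ⟨he, he'⟩⟩, rfl⟩

theorem Format.IsRep.neg {fmt : Format} {x : ℝ} (h : fmt.IsRep x) : fmt.IsRep (-x) := by
  obtain ⟨m, e, hm, he, he', rfl⟩ := h
  exact ⟨-m, e, by rwa [abs_neg], he, he', by push_cast; ring⟩

theorem Format.IsRep.abs {fmt : Format} {x : ℝ} (h : fmt.IsRep x) : fmt.IsRep |x| := by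
  rcases abs_choice x with hx | hx <;> rw [hx]
  · exact h
  · exact h.neg

theorem Format.rep_one (fmt : Format) : fmt.IsRep 1 := by
  have h1 := fmt.two_le_prec
  have h2 := fmt.prec_le_emax
  refine ⟨2 ^ (fmt.prec - 1), 0, ?_, by unfold Format.emin; lia, by lia, ?_⟩
  · rw [abs_of_pos (by positivity)]
    exact pow_lt_pow_right₀ (by norm_num) (by lia)
  · have : (0 : ℤ) - ((fmt.prec : ℤ) - 1) = -((fmt.prec - 1 : ℕ) : ℤ) := by lia
    rw [this, zpow_neg, zpow_natCast]
    push_cast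
    exact (mul_inv_cancel₀ (by positivity)).symm

theorem Format.rep_two (fmt : Format) : fmt.IsRep 2 := by
  have h1 := fmt.two_le_prec
  have h2 := fmt.prec_le_emax
  refine ⟨2 ^ (fmt.prec - 1), 1, ?_, by unfold Format.emin; lia, by lia, ?_⟩
  · rw [abs_of_pos (by positivity)]
    exact pow_lt_pow_right₀ (by norm_num) (by lia)
  · have : (1 : ℤ) - ((fmt.prec : ℤ) - 1) = 1 - ((fmt.prec - 1 : ℕ) : ℤ) := by lia
    rw [this, zpow_sub₀ (by norm_num), zpow_natCast, zpow_one]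
    push_cast
    field_simp

theorem Format.exists_floor (fmt : Format) {z : ℝ} (h : ∃ y, fmt.IsRep y ∧ y ≤ z) :
    ∃ y, IsGreatest {y | fmt.IsRep y ∧ y ≤ z} y := by
  obtain ⟨y, hy, hmax⟩ := Set.exists_max_image {y | fmt.IsRep y ∧ y ≤ z} id
    (fmt.finite_rep.subset fun _ hx => hx.1) h
  exact ⟨y, hy, fun x hx => hmax x hx⟩

theorem Format.exists_ceil (fmt : Format) {z : ℝ} (h : ∃ y, fmt.IsRep y ∧ z ≤ y) :
    ∃ y, IsLeast {y | fmt.IsRep y ∧ z ≤ y} y := by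
  obtain ⟨y, hy, hmin⟩ := Set.exists_min_image {y | fmt.IsRep y ∧ z ≤ y} id
    (fmt.finite_rep.subset fun _ hx => hx.1) h
  exact ⟨y, hy, fun x hx => hmin x hx⟩

/-- Floating point data: signed zeros, nonzero finite numbers, signed infinities, and NaN.
The Boolean is the sign bit (`true` is negative). -/
inductive Fl (fmt : Format) where
  | zero (s : Bool)
  | num (x : ℝ) (ne : x ≠ 0) (rep : fmt.IsRep x)
  | inf (s : Bool)
  | nan

namespace Fl

variable {fmt : Format}

/-- The number denoted by a finite datum (the value on infinities and NaN is a dummy). -/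
def toReal : Fl fmt → ℝ
  | zero _ => 0
  | num x _ _ => x
  | inf _ => 0
  | nan => 0

def IsFinite : Fl fmt → Prop
  | zero _ => True
  | num _ _ _ => True
  | inf _ => False
  | nan => False

open Classical in
/-- The sign bit. -/
def sign : Fl fmt → Bool
  | zero s => s
  | num x _ _ => decide (x < 0)
  | inf s => s
  | nan => false

/-- `x ≤ a` for a real number `x` and a floating point datum `a`: everything is below `+∞`,
nothing is below `-∞`, and nothing is below NaN. -/
def Bounds (a : Fl fmt) (x : ℝ) : Prop :=
  match a with
  | zero _ => x ≤ 0
  | num y _ _ => x ≤ y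
  | inf s => s = false
  | nan => False

def one : Fl fmt := num 1 one_ne_zero fmt.rep_one

def two : Fl fmt := num 2 two_ne_zero fmt.rep_two

open Classical in
/-- The datum with value `y`, with sign bit `s` if `y = 0`. -/
def mk (s : Bool) (y : ℝ) (hy : fmt.IsRep y) : Fl fmt :=
  if h : y = 0 then zero s else num y h hy

end Fl

/-- The four IEEE 754 rounding modes. -/
inductive Mode where
  | down
  | up
  | towardZero
  | nearestEven

variable {fmt : Format}

open Classical in
/-- Rounding downwards: the greatest datum of the format that is at most `z`. -/
def roundDown (s : Bool) (z : ℝ) : Fl fmt :=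
  if h : ∃ y, fmt.IsRep y ∧ y ≤ z then
    Fl.mk s (fmt.exists_floor h).choose (fmt.exists_floor h).choose_spec.1.1
  else Fl.inf true

open Classical in
/-- Rounding upwards: the least datum of the format that is at least `z`. -/
def roundUp (s : Bool) (z : ℝ) : Fl fmt :=
  if h : ∃ y, fmt.IsRep y ∧ z ≤ y then
    Fl.mk s (fmt.exists_ceil h).choose (fmt.exists_ceil h).choose_spec.1.1
  else Fl.inf false

open Classical in
/-- Rounding to nearest, ties to even, with the overflow threshold of IEEE 754. -/
def roundNearest (s : Bool) (z : ℝ) : Fl fmt :=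
  if (2 : ℝ) ^ fmt.emax * (2 - (1 / 2) ^ fmt.prec) ≤ |z| then Fl.inf (decide (z < 0))
  else
    let l : Fl fmt := roundDown s z
    let u : Fl fmt := roundUp s z
    if ¬ l.IsFinite then u
    else if ¬ u.IsFinite then l
    else if z - l.toReal < u.toReal - z then l
    else if u.toReal - z < z - l.toReal then u
    else if fmt.IsEven l.toReal then l
    else u

open Classical in
/-- The datum that represents the real number `z` in a rounding mode. If the result is a zero,
its sign bit is the sign of `z`, or `s` if `z` itself is zero. -/
def round (mode : Mode) (s : Bool) (z : ℝ) : Fl fmt :=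
  let t : Bool := if z < 0 then true else if 0 < z then false else s
  match mode with
  | .down => roundDown t z
  | .up => roundUp t z
  | .towardZero => if z < 0 then roundUp t z else roundDown t z
  | .nearestEven => roundNearest t z

namespace Fl

/-- Negation (exact). -/
def neg : Fl fmt → Fl fmt
  | zero s => zero !s
  | num x h r => num (-x) (neg_ne_zero.mpr h) r.neg
  | inf s => inf !s
  | nan => nan

/-- Absolute value (exact). -/
def abs : Fl fmt → Fl fmt
  | zero _ => zero false
  | num x h r => num |x| (abs_ne_zero.mpr h) r.abs
  | inf _ => inf false
  | nan => nan

open Classical in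
/-- The sign bit of an exact zero sum. -/
def zeroSumSign (mode : Mode) (a b : Fl fmt) : Bool :=
  if a.sign = b.sign then a.sign else
    match mode with
    | .down => true
    | _ => false

open Classical in
def add (mode : Mode) (a b : Fl fmt) : Fl fmt :=
  if a.IsFinite ∧ b.IsFinite then round mode (zeroSumSign mode a b) (a.toReal + b.toReal)
  else
    match a, b with
    | nan, _ => nan
    | _, nan => nan
    | inf s, inf t => if s = t then inf s else nan
    | inf s, _ => inf s
    | _, b => b

def sub (mode : Mode) (a b : Fl fmt) : Fl fmt := add mode a (neg b)

open Classical in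
def mul (mode : Mode) (a b : Fl fmt) : Fl fmt :=
  if a.IsFinite ∧ b.IsFinite then round mode (xor a.sign b.sign) (a.toReal * b.toReal)
  else
    match a, b with
    | nan, _ => nan
    | _, nan => nan
    | zero _, _ => nan
    | _, zero _ => nan
    | a, b => inf (xor a.sign b.sign)

open Classical in
def div (mode : Mode) (a b : Fl fmt) : Fl fmt :=
  if a.IsFinite ∧ b.IsFinite ∧ b.toReal ≠ 0 then
    round mode (xor a.sign b.sign) (a.toReal / b.toReal)
  else
    match a, b with
    | nan, _ => nan
    | _, nan => nan
    | inf _, inf _ => nan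
    | zero _, zero _ => nan
    | a, inf t => zero (xor a.sign t)
    | a, b => inf (xor a.sign b.sign)

open Classical in
/-- The comparison `a < b` (false if an argument is NaN). -/
def lt : Fl fmt → Fl fmt → Bool
  | nan, _ => false
  | _, nan => false
  | inf s, inf t => s && !t
  | inf s, _ => s
  | _, inf t => !t
  | a, b => decide (a.toReal < b.toReal)

/-- The larger argument (exact), or NaN if an argument is NaN. -/
def max : Fl fmt → Fl fmt → Fl fmt
  | nan, _ => nan
  | _, nan => nan
  | a, b => if lt a b then b else a

end Fl

/-! ### Counting floating point operations -/

/-- A value together with the number of floating point operations spent on it. -/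
structure Counted (α : Type) where
  val : α
  cost : ℕ

instance : Monad Counted where
  pure a := ⟨a, 0⟩
  bind x f := ⟨(f x.val).val, x.cost + (f x.val).cost⟩

/-- One floating point operation. -/
def tick {α : Type} (a : α) : Counted α := ⟨a, 1⟩

/-! The operations of the machine; each one costs one unit. -/

def fadd (mode : Mode) (a b : Fl fmt) : Counted (Fl fmt) := tick (Fl.add mode a b)
def fsub (mode : Mode) (a b : Fl fmt) : Counted (Fl fmt) := tick (Fl.sub mode a b)
def fmul (mode : Mode) (a b : Fl fmt) : Counted (Fl fmt) := tick (Fl.mul mode a b)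
def fdiv (mode : Mode) (a b : Fl fmt) : Counted (Fl fmt) := tick (Fl.div mode a b)
def fneg (a : Fl fmt) : Counted (Fl fmt) := tick (Fl.neg a)
def fabs (a : Fl fmt) : Counted (Fl fmt) := tick (Fl.abs a)
def fmax (a b : Fl fmt) : Counted (Fl fmt) := tick (Fl.max a b)
def flt (a b : Fl fmt) : Counted Bool := tick (Fl.lt a b)

/-- Floating point matrices. -/
abbrev FMat (fmt : Format) (n : ℕ) : Type := Matrix (Fin n) (Fin n) (Fl fmt)

variable {n : ℕ}

/-- Compute the entries of a row one after the other. -/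
def vector (f : Fin n → Counted (Fl fmt)) : Counted (Fin n → Fl fmt) :=
  ⟨fun i => (f i).val, ∑ i, (f i).cost⟩

/-- Compute the entries of a matrix one after the other. -/
def matrix (f : Fin n → Fin n → Counted (Fl fmt)) : Counted (FMat fmt n) :=
  ⟨fun i j => (f i j).val, ∑ i, ∑ j, (f i j).cost⟩

/-- Compute the entries of the upper triangle; the other entries are zero. -/
def upper (f : Fin n → Fin n → Counted (Fl fmt)) : Counted (FMat fmt n) :=
  matrix fun i j => if i ≤ j then f i j else pure (Fl.zero false)

/-- Compute the entries of the upper triangle, and copy them to the lower triangle. -/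
def symmetric (f : Fin n → Fin n → Counted (Fl fmt)) : Counted (FMat fmt n) := do
  let M ← upper f
  return fun i j => if i ≤ j then M i j else M j i

/-! Ranges of summation, in increasing order. -/

def allIdx (n : ℕ) : List (Fin n) := List.finRange n
def idxLE (j : Fin n) : List (Fin n) := (List.finRange n).filter fun k => k ≤ j
def idxIcc (i j : Fin n) : List (Fin n) := (List.finRange n).filter fun k => i ≤ k ∧ k ≤ j
def idxIoc (i j : Fin n) : List (Fin n) := (List.finRange n).filter fun k => i < k ∧ k ≤ j

/-- The sum of the products `u k * v k` over a range, one product and one addition per index. -/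
def dot (mode : Mode) (ks : List (Fin n)) (u v : Fin n → Fl fmt) : Counted (Fl fmt) :=
  ks.foldlM (fun acc k => do
    let p ← fmul mode (u k) (v k)
    fadd mode acc p) (Fl.zero false)

/-- The entries of the identity matrix, multiplied by `c`. -/
def scalarEntry (c : Fl fmt) (i j : Fin n) : Fl fmt := if i = j then c else Fl.zero false

/-! ### The error bounding algorithm -/

/-- Numerical inversion of an upper triangular matrix by back substitution, from the last row to
the first one: `v i i = 1 / r i i`, and `v i j = -(∑ k ∈ (i, j], r i k * v k j) / r i i`. -/
def triInverse (mode : Mode) (R : FMat fmt n) : Counted (FMat fmt n) :=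
  (List.finRange n).reverse.foldlM (fun V i => do
    let row ← vector fun j =>
      if j < i then pure (Fl.zero false)
      else if j = i then fdiv mode Fl.one (R i i)
      else do
        let s ← dot mode (idxIoc i j) (fun k => R i k) (fun k => V k j)
        let t ← fneg s
        fdiv mode t (R i i)
    return Function.update V i row) (fun _ _ => Fl.zero false)

/-- A bound on `|x - c|` for `x` between `lo` and `hi`. -/
def absSub (lo hi c : Fl fmt) : Counted (Fl fmt) := do
  let l ← fsub .down lo c
  let h ← fsub .up hi c
  let l' ← fabs l
  let h' ← fabs h
  fmax l' h'

/-- An upper bound on the infinity norm of a matrix with nonnegative entries. -/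
def normInf (M : FMat fmt n) : Counted (Fl fmt) := do
  let sums ← vector fun i =>
    (allIdx n).foldlM (fun acc j => fadd .up acc (M i j)) (Fl.zero false)
  (allIdx n).foldlM (fun acc i => fmax acc (sums i)) (Fl.zero false)

/-- An upper bound on `g ^ 2 / (1 - g)`; the lower bound on `1 - g` is the negative of an upper
bound on `g - 1`. -/
def tailBound (g : Fl fmt) : Counted (Fl fmt) := do
  let d ← fsub .up g Fl.one
  let t ← fneg d
  let q ← fdiv .up Fl.one t
  let s ← fmul .up g g
  fmul .up s q

/-- A bound on `|Mᵀ * M - I|` for a matrix `M` known to lie between `lo` and `hi`, through a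
midpoint and radius representation. For `i ≤ j`, entry `(i, j)` of a product is a sum over
`range i`. -/
def gramBound (range : Fin n → List (Fin n)) (lo hi : FMat fmt n) : Counted (FMat fmt n) := do
  let mid ← matrix fun i j => do
    let s ← fadd .up (hi i j) (lo i j)
    fdiv .up s Fl.two
  let rad ← matrix fun i j => fsub .up (mid i j) (lo i j)
  let amid ← matrix fun i j => fabs (mid i j)
  let sup ← matrix fun i j => fadd .up (amid i j) (rad i j)
  let dn ← upper fun i j => dot .down (range i) (fun k => mid k i) (fun k => mid k j)
  let up ← upper fun i j => dot .up (range i) (fun k => mid k i) (fun k => mid k j)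
  let P ← upper fun i j => dot .up (range i) (fun k => amid k i) (fun k => rad k j)
  let Q ← upper fun i j => dot .up (range i) (fun k => rad k i) (fun k => sup k j)
  symmetric fun i j => do
    let c ← absSub (dn i j) (up i j) (scalarEntry Fl.one i j)
    let s ← fadd .up c (P i j)
    fadd .up s (Q i j)

/-- The error bounding algorithm. The mode is the one used for the approximate inverse `V`, for
which no rounding mode is prescribed. If one of the two tests fails, then all entries of the
result are `+∞`. -/
def errorBound (mode : Mode) (A R : FMat fmt n) : Counted (FMat fmt n) := do
  -- approximate inverse, enclosure of `W = R * V`, and invertibility test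
  let V ← triInverse mode R
  let Wlo ← upper fun i j => dot .down (idxIcc i j) (fun k => R i k) (fun k => V k j)
  let Whi ← upper fun i j => dot .up (idxIcc i j) (fun k => R i k) (fun k => V k j)
  let E ← upper fun i j => absSub (Wlo i j) (Whi i j) (scalarEntry Fl.one i j)
  let w ← normInf E
  let invertible ← flt w Fl.one
  -- bound `U` on `|W⁻¹|`, from `|W - 2 I|` and the norm of `W - I`
  let c ← tailBound w
  let U ← upper fun i j => do
    let d ← absSub (Wlo i j) (Whi i j) (scalarEntry Fl.two i j)
    fadd .up d c
  -- bound `S` on `|Vᵀ Aᵀ A V - I| + |Wᵀ W - I|`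
  let SW ← gramBound idxLE Wlo Whi
  let Blo ← matrix fun i j => dot .down (idxLE j) (fun k => A i k) (fun k => V k j)
  let Bhi ← matrix fun i j => dot .up (idxLE j) (fun k => A i k) (fun k => V k j)
  let SA ← gramBound (fun _ => allIdx n) Blo Bhi
  let S ← symmetric fun i j => fadd .up (SA i j) (SW i j)
  -- bound on `G`: the symmetric product `Uᵀ S U`, and spectral radius test
  let T ← matrix fun i j => dot .up (idxLE j) (fun k => S i k) (fun k => U k j)
  let G ← symmetric fun i j => dot .up (idxLE i) (fun k => U k i) (fun k => T k j)
  let g ← normInf G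
  let contracting ← flt g Fl.one
  -- bound `H` on the upper triangle of `G (I - G)⁻¹`, and final product `H |R|`
  let h ← tailBound g
  let H ← upper fun i j => fadd .up (G i j) h
  let absR ← upper fun i j => fabs (R i j)
  let F ← upper fun i j => dot .up (idxIcc i j) (fun k => H i k) (fun k => absR k j)
  return if invertible && contracting then F else fun _ _ => Fl.inf false

/-! ### The exact factor -/

/-- `R` is the `QR` factor of `A`: `A = Q R` with `Q` orthogonal and `R` upper triangular with
positive diagonal entries. -/
def IsQRFactor (A R : Matrix (Fin n) (Fin n) ℝ) : Prop :=
  (∀ i j, j < i → R i j = 0) ∧ (∀ i, 0 < R i i) ∧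
    ∃ Q ∈ Matrix.orthogonalGroup (Fin n) ℝ, A = Q * R

end CertQR

end

/-! Write `R'` for the given triangular matrix, `W = R' V`, `B = A V`, `X = W⁻¹`. Entrywise
closeness of the triangular `W` to `1` gives a nonzero diagonal, so `W` and `R'` are invertible and
`R'⁻¹ = V X`. No accuracy of `V` is assumed: the test `w < 1` measures it. Put `C = R R'⁻¹`, which
is upper triangular with positive diagonal. Orthogonality of `Q` gives `CᵀC = 1 + E` with `E = Xᵀ
(BᵀB - WᵀW) X`, so `C` is the Cholesky factor of a perturbed identity and `R - R' = (C - 1) R'`.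

Three estimates carry the real part. `abs_inv_le` bounds `|X|` by a Neumann expansion of order two,
`abs_gram_sub_le` bounds `BᵀB - 1` and `WᵀW - 1` from midpoints and radii, and
`abs_cholesky_sub_one_le` bounds `C - 1` from a bound on `|E|`.

The floating point part must survive overflow and NaN. `Above` and `Below` are stable under directed
sums, but a product `0 * ∞` is NaN. The tests settle this: a nonnegative datum that passes `< 1` is
finite, and finiteness propagates backwards through sums, products and maxima to every entry that
entered the datum. After the tests, `tailBound_spec` keeps `H` finite, so the last product has
finite factors and can only overflow to `+∞`, which is still a bound.

The operation count is exact, because the cost of each step does not depend on the data. -/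

namespace CertQR

variable {fmt : Format} {n : ℕ}

/-! ### Directed rounding, overflow and propagation of finiteness -/

namespace Fl

theorem isFinite_mk (s : Bool) (y : ℝ) (hy : fmt.IsRep y) : (mk s y hy).IsFinite := by
  unfold mk; split_ifs <;> trivial

theorem toReal_mk (s : Bool) (y : ℝ) (hy : fmt.IsRep y) : (mk s y hy).toReal = y := by
  unfold mk; split_ifs with h
  · exact h.symm
  · rfl

theorem isRep_toReal (a : Fl fmt) : fmt.IsRep a.toReal := by
  have h0 : fmt.IsRep 0 :=
    ⟨0, fmt.emin, by simp, le_rfl, by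
      have := fmt.two_le_prec
      have := fmt.prec_le_emax
      unfold Format.emin; lia, by simp⟩
  cases a <;> first | exact h0 | assumption

/-- The result of an upward rounded operation with exact result at least `x`. -/
def Above (a : Fl fmt) (x : ℝ) : Prop := a = inf false ∨ a.IsFinite ∧ x ≤ a.toReal

/-- The result of a downward rounded operation with exact result at most `x`. -/
def Below (a : Fl fmt) (x : ℝ) : Prop := a = inf true ∨ a.IsFinite ∧ a.toReal ≤ x

theorem Above.bounds {a : Fl fmt} {x : ℝ} (h : a.Above x) : a.Bounds x := by
  rcases h with rfl | ⟨h, hx⟩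
  · rfl
  · cases a <;> first | exact hx | exact h.elim

theorem above_zero (s : Bool) : (zero s : Fl fmt).Above 0 := Or.inr ⟨trivial, le_rfl⟩

theorem below_zero (s : Bool) : (zero s : Fl fmt).Below 0 := Or.inr ⟨trivial, le_rfl⟩

theorem Above.mono {a : Fl fmt} {x y : ℝ} (h : a.Above x) (hy : y ≤ x) : a.Above y :=
  h.imp_right fun h => ⟨h.1, hy.trans h.2⟩

theorem Below.mono {a : Fl fmt} {x y : ℝ} (h : a.Below x) (hy : x ≤ y) : a.Below y :=
  h.imp_right fun h => ⟨h.1, h.2.trans hy⟩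

theorem Above.le {a : Fl fmt} {x : ℝ} (h : a.Above x) (ha : a.IsFinite) : x ≤ a.toReal := by
  rcases h with rfl | h
  · exact ha.elim
  · exact h.2

theorem Below.le {a : Fl fmt} {x : ℝ} (h : a.Below x) (ha : a.IsFinite) : a.toReal ≤ x := by
  rcases h with rfl | h
  · exact ha.elim
  · exact h.2

theorem above_roundUp (s : Bool) (z : ℝ) : (roundUp s z : Fl fmt).Above z := by
  unfold roundUp
  split_ifs with h
  · exact Or.inr ⟨isFinite_mk _ _ _, by rw [toReal_mk]; exact (fmt.exists_ceil h).choose_spec.1.2⟩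
  · exact Or.inl rfl

theorem below_roundDown (s : Bool) (z : ℝ) : (roundDown s z : Fl fmt).Below z := by
  unfold roundDown
  split_ifs with h
  · exact Or.inr ⟨isFinite_mk _ _ _, by rw [toReal_mk]; exact (fmt.exists_floor h).choose_spec.1.2⟩
  · exact Or.inl rfl

/-- The tool against overflow: any representable number above the exact value caps the rounded one.
-/
theorem roundUp_le_rep (s : Bool) {z y : ℝ} (hy : fmt.IsRep y) (hz : z ≤ y) :
    (roundUp s z : Fl fmt).IsFinite ∧ (roundUp s z : Fl fmt).toReal ≤ y := by
  have h : ∃ y, fmt.IsRep y ∧ z ≤ y := ⟨y, hy, hz⟩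
  unfold roundUp
  rw [dif_pos h]
  exact ⟨isFinite_mk _ _ _, by rw [toReal_mk]; exact (fmt.exists_ceil h).choose_spec.2 ⟨hy, hz⟩⟩

theorem isFinite_neg {a : Fl fmt} : a.neg.IsFinite ↔ a.IsFinite := by
  cases a <;> rfl

theorem toReal_neg (a : Fl fmt) : a.neg.toReal = -a.toReal := by
  cases a <;> simp [neg, toReal]

theorem isFinite_abs {a : Fl fmt} : a.abs.IsFinite ↔ a.IsFinite := by
  cases a <;> rfl

theorem toReal_abs (a : Fl fmt) : a.abs.toReal = |a.toReal| := by
  cases a <;> simp [abs, toReal]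

/-- Infinities and NaN are never absorbed by a sum, so a finite result certifies its operands.
Division lacks this property, since a finite number divided by an infinity is zero. -/
theorem isFinite_of_add {m : Mode} {a b : Fl fmt} (h : (add m a b).IsFinite) :
    a.IsFinite ∧ b.IsFinite := by
  by_contra hab
  unfold add at h
  rw [if_neg hab] at h
  cases a <;> cases b <;> simp_all [IsFinite]
  split_ifs at h <;> exact h

theorem isFinite_of_sub {m : Mode} {a b : Fl fmt} (h : (sub m a b).IsFinite) :
    a.IsFinite ∧ b.IsFinite :=
  ⟨(isFinite_of_add h).1, isFinite_neg.1 (isFinite_of_add h).2⟩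

theorem isFinite_of_mul {m : Mode} {a b : Fl fmt} (h : (mul m a b).IsFinite) :
    a.IsFinite ∧ b.IsFinite := by
  by_contra hab
  unfold mul at h
  rw [if_neg hab] at h
  cases a <;> cases b <;> simp_all [IsFinite]

theorem add_up_eq {a b : Fl fmt} (ha : a.IsFinite) (hb : b.IsFinite) :
    ∃ s, add .up a b = roundUp s (a.toReal + b.toReal) :=
  ⟨_, by unfold add; rw [if_pos ⟨ha, hb⟩]; rfl⟩

theorem add_down_eq {a b : Fl fmt} (ha : a.IsFinite) (hb : b.IsFinite) :
    ∃ s, add .down a b = roundDown s (a.toReal + b.toReal) :=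
  ⟨_, by unfold add; rw [if_pos ⟨ha, hb⟩]; rfl⟩

theorem mul_up_eq {a b : Fl fmt} (ha : a.IsFinite) (hb : b.IsFinite) :
    ∃ s, mul .up a b = roundUp s (a.toReal * b.toReal) :=
  ⟨_, by unfold mul; rw [if_pos ⟨ha, hb⟩]; rfl⟩

theorem mul_down_eq {a b : Fl fmt} (ha : a.IsFinite) (hb : b.IsFinite) :
    ∃ s, mul .down a b = roundDown s (a.toReal * b.toReal) :=
  ⟨_, by unfold mul; rw [if_pos ⟨ha, hb⟩]; rfl⟩

theorem div_up_eq {a b : Fl fmt} (ha : a.IsFinite) (hb : b.IsFinite) (h0 : b.toReal ≠ 0) :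
    ∃ s, div .up a b = roundUp s (a.toReal / b.toReal) :=
  ⟨_, by unfold div; rw [if_pos ⟨ha, hb, h0⟩]; rfl⟩

theorem above_add {a b : Fl fmt} (ha : a.IsFinite) (hb : b.IsFinite) :
    (add .up a b).Above (a.toReal + b.toReal) := by
  obtain ⟨s, hs⟩ := add_up_eq ha hb
  rw [hs]; exact above_roundUp _ _

theorem below_add {a b : Fl fmt} (ha : a.IsFinite) (hb : b.IsFinite) :
    (add .down a b).Below (a.toReal + b.toReal) := by
  obtain ⟨s, hs⟩ := add_down_eq ha hb
  rw [hs]; exact below_roundDown _ _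

theorem above_mul {a b : Fl fmt} (ha : a.IsFinite) (hb : b.IsFinite) :
    (mul .up a b).Above (a.toReal * b.toReal) := by
  obtain ⟨s, hs⟩ := mul_up_eq ha hb
  rw [hs]; exact above_roundUp _ _

theorem below_mul {a b : Fl fmt} (ha : a.IsFinite) (hb : b.IsFinite) :
    (mul .down a b).Below (a.toReal * b.toReal) := by
  obtain ⟨s, hs⟩ := mul_down_eq ha hb
  rw [hs]; exact below_roundDown _ _

theorem above_sub {a b : Fl fmt} (ha : a.IsFinite) (hb : b.IsFinite) :
    (sub .up a b).Above (a.toReal - b.toReal) := by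
  have := above_add ha (isFinite_neg.2 hb)
  rwa [toReal_neg, ← sub_eq_add_neg] at this

theorem below_sub {a b : Fl fmt} (ha : a.IsFinite) (hb : b.IsFinite) :
    (sub .down a b).Below (a.toReal - b.toReal) := by
  have := below_add ha (isFinite_neg.2 hb)
  rwa [toReal_neg, ← sub_eq_add_neg] at this

theorem add_up_ge {a b : Fl fmt} (h : (add .up a b).IsFinite) :
    a.toReal + b.toReal ≤ (add .up a b).toReal :=
  (above_add (isFinite_of_add h).1 (isFinite_of_add h).2).le h

theorem sub_up_ge {a b : Fl fmt} (h : (sub .up a b).IsFinite) :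
    a.toReal - b.toReal ≤ (sub .up a b).toReal :=
  (above_sub (isFinite_of_sub h).1 (isFinite_of_sub h).2).le h

theorem sub_down_le {a b : Fl fmt} (h : (sub .down a b).IsFinite) :
    (sub .down a b).toReal ≤ a.toReal - b.toReal :=
  (below_sub (isFinite_of_sub h).1 (isFinite_of_sub h).2).le h

/-- `Above` excludes `-∞`, so the NaN of `∞ - ∞` cannot arise. -/
theorem Above.add {a b : Fl fmt} {x y : ℝ} (ha : a.Above x) (hb : b.Above y) :
    (add .up a b).Above (x + y) := by
  rcases ha with rfl | ⟨ha, hx⟩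
  · left
    rcases hb with rfl | ⟨hb, -⟩
    · simp [Fl.add, IsFinite]
    · cases b <;> simp_all [Fl.add, IsFinite]
  · rcases hb with rfl | ⟨hb, hy⟩
    · left
      cases a <;> simp_all [Fl.add, IsFinite]
    · exact (above_add ha hb).mono (add_le_add hx hy)

theorem Below.add {a b : Fl fmt} {x y : ℝ} (ha : a.Below x) (hb : b.Below y) :
    (add .down a b).Below (x + y) := by
  rcases ha with rfl | ⟨ha, hx⟩
  · left
    rcases hb with rfl | ⟨hb, -⟩
    · simp [Fl.add, IsFinite]
    · cases b <;> simp_all [Fl.add, IsFinite]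
  · rcases hb with rfl | ⟨hb, hy⟩
    · left
      cases a <;> simp_all [Fl.add, IsFinite]
    · exact (below_add ha hb).mono (add_le_add hx hy)

theorem isFinite_one : (one : Fl fmt).IsFinite := trivial

theorem toReal_one : (one : Fl fmt).toReal = 1 := rfl

theorem isFinite_two : (two : Fl fmt).IsFinite := trivial

theorem toReal_two : (two : Fl fmt).toReal = 2 := rfl

theorem isFinite_of_div_two {a : Fl fmt} (h : (div .up a two).IsFinite) : a.IsFinite := by
  by_contra ha
  cases a <;> simp_all [IsFinite, div, two]

theorem div_two_ge {a : Fl fmt} (h : (div .up a two).IsFinite) :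
    a.toReal / 2 ≤ (div .up a two).toReal := by
  obtain ⟨s, hs⟩ := div_up_eq (isFinite_of_div_two h) isFinite_two two_ne_zero
  rw [hs] at h ⊢
  exact (above_roundUp _ _).le h

/-! ### Nonnegative data, comparisons and maxima -/

/-- NaN, `+∞`, or a finite nonnegative datum. -/
def Nonneg (a : Fl fmt) : Prop := a = nan ∨ a.Above 0

theorem nonneg_zero (s : Bool) : (zero s : Fl fmt).Nonneg := Or.inr (Or.inr ⟨trivial, le_rfl⟩)

theorem Nonneg.toReal_nonneg {a : Fl fmt} (h : a.Nonneg) : 0 ≤ a.toReal := by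
  rcases h with rfl | rfl | h
  · exact le_rfl
  · exact le_rfl
  · exact h.2

theorem nonneg_abs (a : Fl fmt) : a.abs.Nonneg := by
  cases a
  · exact nonneg_zero _
  · exact Or.inr (Or.inr ⟨trivial, abs_nonneg _⟩)
  · exact Or.inr (Or.inl rfl)
  · exact Or.inl rfl

theorem nan_add (m : Mode) (b : Fl fmt) : add m nan b = nan := by
  simp [add, IsFinite]

theorem add_nan (m : Mode) (a : Fl fmt) : add m a nan = nan := by
  cases a <;> simp [add, IsFinite]

theorem nan_mul (m : Mode) (b : Fl fmt) : mul m nan b = nan := by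
  simp [mul, IsFinite]

theorem mul_nan (m : Mode) (a : Fl fmt) : mul m a nan = nan := by
  cases a <;> simp [mul, IsFinite]

theorem Nonneg.add {a b : Fl fmt} (ha : a.Nonneg) (hb : b.Nonneg) : (add .up a b).Nonneg := by
  rcases ha with rfl | ha
  · exact Or.inl (nan_add _ _)
  rcases hb with rfl | hb
  · exact Or.inl (add_nan _ _)
  · exact Or.inr (by simpa using ha.add hb)

theorem Nonneg.mul {a b : Fl fmt} (ha : a.Nonneg) (hb : b.Nonneg) : (mul .up a b).Nonneg := by
  rcases ha with rfl | ha
  · exact Or.inl (nan_mul _ _)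
  rcases hb with rfl | hb
  · exact Or.inl (mul_nan _ _)
  rcases ha with rfl | ⟨ha, hx⟩
  · rcases hb with rfl | ⟨hb, hy⟩
    · exact Or.inr (Or.inl (by simp [Fl.mul, IsFinite, sign]))
    · cases b
      · exact Or.inl (by simp [Fl.mul, IsFinite])
      · exact Or.inr (Or.inl (by simpa [Fl.mul, IsFinite, sign, toReal] using hy))
      · exact hb.elim
      · exact hb.elim
  · rcases hb with rfl | ⟨hb, hy⟩
    · cases a
      · exact Or.inl (by simp [Fl.mul, IsFinite])
      · exact Or.inr (Or.inl (by simpa [Fl.mul, IsFinite, sign, toReal] using hx))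
      · exact ha.elim
      · exact ha.elim
    · exact Or.inr ((above_mul ha hb).mono (mul_nonneg hx hy))

theorem lt_eq_decide {a b : Fl fmt} (ha : a.IsFinite) (hb : b.IsFinite) :
    lt a b = decide (a.toReal < b.toReal) := by
  cases a <;> cases b <;> first | rfl | exact ha.elim | exact hb.elim

/-- NaN and `+∞` fail the comparison; `-∞` would pass it and is what `Nonneg` rules out. -/
theorem Nonneg.lt_one {a : Fl fmt} (h : a.Nonneg) (hlt : lt a one = true) :
    a.IsFinite ∧ a.toReal < 1 := by
  rcases h with rfl | rfl | ⟨h, -⟩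
  · simp [lt] at hlt
  · simp [lt, one] at hlt
  · rw [lt_eq_decide h isFinite_one] at hlt
    exact ⟨h, of_decide_eq_true hlt⟩

theorem max_eq_of_isFinite {a b : Fl fmt} (ha : a.IsFinite) (hb : b.IsFinite) :
    (max a b).IsFinite ∧ (max a b).toReal = a.toReal ⊔ b.toReal := by
  have : max a b = if lt a b then b else a := by
    cases a <;> cases b <;> first | rfl | exact ha.elim | exact hb.elim
  rw [this, lt_eq_decide ha hb]
  by_cases h : a.toReal < b.toReal
  · simp [h, hb, h.le]
  · simp [h, ha, not_lt.1 h]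

theorem Nonneg.max {a b : Fl fmt} (ha : a.Nonneg) (hb : b.Nonneg) : (max a b).Nonneg := by
  rcases ha with rfl | rfl | ⟨ha, hx⟩
  · exact Or.inl rfl
  · rcases hb with rfl | rfl | ⟨hb, hy⟩
    · exact Or.inl rfl
    · exact Or.inr (Or.inl rfl)
    · cases b <;> first | exact hb.elim | exact Or.inr (Or.inl rfl)
  · rcases hb with rfl | rfl | ⟨hb, hy⟩
    · cases a <;> exact Or.inl rfl
    · cases a <;> first | exact ha.elim | exact Or.inr (Or.inl rfl)
    · obtain ⟨h, h'⟩ := max_eq_of_isFinite ha hb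
      exact Or.inr (Or.inr ⟨h, by rw [h']; exact le_sup_of_le_left hx⟩)

/-- Nonnegativity is essential: a maximum would hide an operand `-∞`. -/
theorem Nonneg.isFinite_of_max {a b : Fl fmt} (ha : a.Nonneg) (hb : b.Nonneg)
    (h : (Fl.max a b).IsFinite) : a.IsFinite ∧ b.IsFinite := by
  rcases ha with rfl | rfl | ⟨ha, hx⟩
  · exact h.elim
  · rcases hb with rfl | rfl | ⟨hb, hy⟩
    · exact h.elim
    · exact h.elim
    · cases b <;> exact h.elim
  · rcases hb with rfl | rfl | ⟨hb, hy⟩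
    · cases a <;> exact h.elim
    · cases a <;> first | exact ha.elim | exact h.elim
    · exact ⟨ha, hb⟩

end Fl

/-! ### Sums of products -/

theorem dot_val (m : Mode) (ks : List (Fin n)) (u v : Fin n → Fl fmt) :
    (dot m ks u v).val =
      ks.foldl (fun acc k => Fl.add m acc (Fl.mul m (u k) (v k))) (Fl.zero false) := by
  unfold dot
  generalize (Fl.zero false : Fl fmt) = a
  induction ks generalizing a with
  | nil => rfl
  | cons k ks ih => exact ih _

theorem isFinite_of_foldl_add {ι : Type} {m : Mode} (ks : List ι) (f : ι → Fl fmt) (a : Fl fmt)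
    (h : (ks.foldl (fun acc k => Fl.add m acc (f k)) a).IsFinite) :
    a.IsFinite ∧ ∀ k ∈ ks, (f k).IsFinite := by
  induction ks generalizing a with
  | nil => exact ⟨h, by simp⟩
  | cons k ks ih =>
    obtain ⟨h1, h2⟩ := ih _ h
    obtain ⟨h3, h4⟩ := Fl.isFinite_of_add h1
    exact ⟨h3, by simpa using ⟨h4, h2⟩⟩

theorem above_foldl_add {ι : Type} (ks : List ι) (f : ι → Fl fmt) (g : ι → ℝ)
    (hf : ∀ k ∈ ks, (f k).Above (g k)) (a : Fl fmt) (x : ℝ) (ha : a.Above x) :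
    (ks.foldl (fun acc k => Fl.add .up acc (f k)) a).Above (x + (ks.map g).sum) := by
  induction ks generalizing a x with
  | nil => simpa using ha
  | cons k ks ih =>
    rw [List.map_cons, List.sum_cons, ← add_assoc]
    exact ih (fun k hk => hf k (List.mem_cons_of_mem _ hk)) _ _ (ha.add (hf k (by simp)))

theorem below_foldl_add {ι : Type} (ks : List ι) (f : ι → Fl fmt) (g : ι → ℝ)
    (hf : ∀ k ∈ ks, (f k).Below (g k)) (a : Fl fmt) (x : ℝ) (ha : a.Below x) :
    (ks.foldl (fun acc k => Fl.add .down acc (f k)) a).Below (x + (ks.map g).sum) := by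
  induction ks generalizing a x with
  | nil => simpa using ha
  | cons k ks ih =>
    rw [List.map_cons, List.sum_cons, ← add_assoc]
    exact ih (fun k hk => hf k (List.mem_cons_of_mem _ hk)) _ _ (ha.add (hf k (by simp)))

theorem nonneg_foldl_add {ι : Type} (ks : List ι) (f : ι → Fl fmt)
    (hf : ∀ k ∈ ks, (f k).Nonneg) (a : Fl fmt) (ha : a.Nonneg) :
    (ks.foldl (fun acc k => Fl.add .up acc (f k)) a).Nonneg := by
  induction ks generalizing a with
  | nil => exact ha
  | cons k ks ih =>
    exact ih (fun k hk => hf k (List.mem_cons_of_mem _ hk)) _ (ha.add (hf k (by simp)))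

theorem sum_map_eq_sum_ite {ks : List (Fin n)} (hks : ks.Nodup) (g : Fin n → ℝ) :
    (ks.map g).sum = ∑ k, if k ∈ ks then g k else 0 := by
  rw [← List.sum_toFinset g hks, ← Finset.sum_filter]
  congr 1
  ext k
  simp

theorem isFinite_of_dot {m : Mode} {ks : List (Fin n)} {u v : Fin n → Fl fmt}
    (h : (dot m ks u v).val.IsFinite) : ∀ k ∈ ks, (u k).IsFinite ∧ (v k).IsFinite := by
  rw [dot_val] at h
  exact fun k hk => Fl.isFinite_of_mul ((isFinite_of_foldl_add ks _ _ h).2 k hk)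

/-- Finite factors exclude `0 * ∞`; overflow of products and partial sums is still allowed. The
condition off `ks` lets a sum restricted by triangularity bound the full one. -/
theorem above_dot {ks : List (Fin n)} (hks : ks.Nodup) {u v : Fin n → Fl fmt} {g : Fin n → ℝ}
    (hu : ∀ k ∈ ks, (u k).IsFinite ∧ (v k).IsFinite)
    (hg : ∀ k ∈ ks, g k ≤ (u k).toReal * (v k).toReal) (hg0 : ∀ k ∉ ks, g k ≤ 0) :
    (dot .up ks u v).val.Above (∑ k, g k) := by
  rw [dot_val]
  refine (above_foldl_add ks (fun k => Fl.mul .up (u k) (v k)) g (fun k hk =>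
    (Fl.above_mul (hu k hk).1 (hu k hk).2).mono (hg k hk)) _ 0 (Fl.above_zero _)).mono ?_
  rw [zero_add, sum_map_eq_sum_ite hks]
  refine Finset.sum_le_sum fun k _ => ?_
  split_ifs with h
  · exact le_rfl
  · exact hg0 k h

theorem below_dot {ks : List (Fin n)} (hks : ks.Nodup) {u v : Fin n → Fl fmt} {g : Fin n → ℝ}
    (hu : ∀ k ∈ ks, (u k).IsFinite ∧ (v k).IsFinite)
    (hg : ∀ k ∈ ks, (u k).toReal * (v k).toReal ≤ g k) (hg0 : ∀ k ∉ ks, 0 ≤ g k) :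
    (dot .down ks u v).val.Below (∑ k, g k) := by
  rw [dot_val]
  refine (below_foldl_add ks (fun k => Fl.mul .down (u k) (v k)) g (fun k hk =>
    (Fl.below_mul (hu k hk).1 (hu k hk).2).mono (hg k hk)) _ 0 (Fl.below_zero _)).mono ?_
  rw [zero_add, sum_map_eq_sum_ite hks]
  refine Finset.sum_le_sum fun k _ => ?_
  split_ifs with h
  · exact le_rfl
  · exact hg0 k h

theorem le_dot_up {ks : List (Fin n)} (hks : ks.Nodup) {u v : Fin n → Fl fmt} {g : Fin n → ℝ}
    (h : (dot .up ks u v).val.IsFinite)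
    (hg : ∀ k ∈ ks, g k ≤ (u k).toReal * (v k).toReal) (hg0 : ∀ k ∉ ks, g k ≤ 0) :
    ∑ k, g k ≤ (dot .up ks u v).val.toReal :=
  (above_dot hks (isFinite_of_dot h) hg hg0).le h

theorem dot_down_le {ks : List (Fin n)} (hks : ks.Nodup) {u v : Fin n → Fl fmt} {g : Fin n → ℝ}
    (h : (dot .down ks u v).val.IsFinite)
    (hg : ∀ k ∈ ks, (u k).toReal * (v k).toReal ≤ g k) (hg0 : ∀ k ∉ ks, 0 ≤ g k) :
    (dot .down ks u v).val.toReal ≤ ∑ k, g k :=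
  (below_dot hks (isFinite_of_dot h) hg hg0).le h

theorem nonneg_dot {ks : List (Fin n)} {u v : Fin n → Fl fmt}
    (h : ∀ k ∈ ks, (u k).Nonneg ∧ (v k).Nonneg) : (dot .up ks u v).val.Nonneg := by
  rw [dot_val]
  exact nonneg_foldl_add ks _ (fun k hk => (h k hk).1.mul (h k hk).2) _ (Fl.nonneg_zero _)

theorem mem_idxLE {j k : Fin n} : k ∈ idxLE j ↔ k ≤ j := by simp [idxLE]

theorem mem_idxIcc {i j k : Fin n} : k ∈ idxIcc i j ↔ i ≤ k ∧ k ≤ j := by simp [idxIcc]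

theorem mem_allIdx (k : Fin n) : k ∈ allIdx n := by simp [allIdx]

theorem nodup_allIdx (n : ℕ) : (allIdx n).Nodup := List.nodup_finRange n

theorem nodup_idxLE (j : Fin n) : (idxLE j).Nodup := (List.nodup_finRange n).filter _

theorem nodup_idxIcc (i j : Fin n) : (idxIcc i j).Nodup := (List.nodup_finRange n).filter _

theorem upper_val (f : Fin n → Fin n → Counted (Fl fmt)) (i j : Fin n) :
    (upper f).val i j = if i ≤ j then (f i j).val else Fl.zero false := by
  change Counted.val (if i ≤ j then f i j else pure (Fl.zero false)) = _
  split_ifs <;> rfl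

theorem symmetric_val (f : Fin n → Fin n → Counted (Fl fmt)) (i j : Fin n) :
    (symmetric f).val i j = if i ≤ j then (f i j).val else (f j i).val := by
  change (if i ≤ j then (upper f).val i j else (upper f).val j i) = _
  rw [upper_val, upper_val]
  split_ifs with h h'
  · rfl
  · rfl
  · exact absurd (le_of_not_ge h) h'

theorem matrix_val (f : Fin n → Fin n → Counted (Fl fmt)) (i j : Fin n) :
    (matrix f).val i j = (f i j).val := rfl

/-! ### Componentwise perturbation bounds -/

/-- At an index `m` where `y` is largest, the hypothesis reads `y m ≤ c + w * y m`. -/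
theorem le_of_le_add_sum {N : Matrix (Fin n) (Fin n) ℝ} {w c : ℝ} (hw : w < 1)
    (hN : ∀ i j, 0 ≤ N i j) (hs : ∀ i, ∑ j, N i j ≤ w) {y : Fin n → ℝ} (hy0 : ∀ i, 0 ≤ y i)
    (hy : ∀ i, y i ≤ c + ∑ k, N i k * y k) (i : Fin n) : y i ≤ c / (1 - w) := by
  obtain ⟨m, -, hm⟩ := Finset.exists_max_image Finset.univ y ⟨i, Finset.mem_univ i⟩
  refine (hm i (Finset.mem_univ i)).trans ?_
  have h1 : ∑ k, N m k * y k ≤ w * y m := by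
    calc ∑ k, N m k * y k ≤ ∑ k, N m k * y m := Finset.sum_le_sum fun k _ =>
          mul_le_mul_of_nonneg_left (hm k (Finset.mem_univ k)) (hN m k)
      _ = (∑ k, N m k) * y m := by rw [Finset.sum_mul]
      _ ≤ w * y m := mul_le_mul_of_nonneg_right (hs m) (hy0 m)
  rw [le_div_iff₀ (by linarith)]
  nlinarith [hy m]

theorem sum_mul_le_mul {N : Fin n → ℝ} {y : Fin n → ℝ} {w c : ℝ} (hN : ∀ k, 0 ≤ N k)
    (hs : ∑ k, N k ≤ w) (hc : 0 ≤ c) (hy : ∀ k, y k ≤ c) : ∑ k, N k * y k ≤ w * c :=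
  calc ∑ k, N k * y k ≤ ∑ k, N k * c :=
        Finset.sum_le_sum fun k _ => mul_le_mul_of_nonneg_left (hy k) (hN k)
    _ = (∑ k, N k) * c := by rw [Finset.sum_mul]
    _ ≤ w * c := mul_le_mul_of_nonneg_right hs hc

theorem abs_mul_apply_le (M N : Matrix (Fin n) (Fin n) ℝ) (i j : Fin n) :
    |(M * N) i j| ≤ ∑ k, |M i k| * |N k j| := by
  rw [Matrix.mul_apply]
  refine (Finset.abs_sum_le_sum_abs _ _).trans (le_of_eq ?_)
  simp [abs_mul]

theorem isUnit_of_upper {W : Matrix (Fin n) (Fin n) ℝ} (htri : ∀ i j, j < i → W i j = 0)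
    (hd : ∀ i, W i i ≠ 0) : IsUnit W.det := by
  rw [Matrix.det_of_isUpperTriangular (fun i j h => htri i j h)]
  exact isUnit_iff_ne_zero.2 (Finset.prod_ne_zero_iff.2 fun i _ => hd i)

theorem inv_upper {W : Matrix (Fin n) (Fin n) ℝ} (htri : ∀ i j, j < i → W i j = 0)
    (hW : IsUnit W.det) {i j : Fin n} (h : j < i) : W⁻¹ i j = 0 := by
  have := Matrix.invertibleOfIsUnitDet W hW
  exact Matrix.blockTriangular_inv_of_blockTriangular (b := id)
    (fun i j h => htri i j h) h

/-- Invertibility of a triangular matrix close to the identity, and a bound on its inverse. -/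
theorem abs_inv_le {W : Matrix (Fin n) (Fin n) ℝ} (htri : ∀ i j, j < i → W i j = 0) {w : ℝ}
    (hw : w < 1) (hs : ∀ i, ∑ j, |(W - 1) i j| ≤ w) :
    IsUnit W.det ∧ ∀ i j, |W⁻¹ i j| ≤ |((2 : ℝ) • (1 : Matrix (Fin n) (Fin n) ℝ) - W) i j|
      + w ^ 2 / (1 - w) := by
  have hentry : ∀ i j, |(W - 1) i j| ≤ w := fun i j =>
    (Finset.single_le_sum (f := fun j => |(W - 1) i j|) (fun _ _ => abs_nonneg _)
      (Finset.mem_univ j)).trans (hs i)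
  -- A zero diagonal entry of `W` would give `W - 1` an entry of modulus `1 > w`.
  have hunit : IsUnit W.det := by
    refine isUnit_of_upper htri fun i h => ?_
    have := hentry i i
    rw [Matrix.sub_apply, h, Matrix.one_apply_eq] at this
    norm_num at this
    linarith
  refine ⟨hunit, fun i j => ?_⟩
  have hw0 : 0 ≤ w := (abs_nonneg _).trans (hentry i j)
  have h1w : 0 < 1 - w := by linarith
  have hWW : W * W⁻¹ = 1 := Matrix.mul_nonsing_inv W hunit
  have h1 : W⁻¹ = 1 - (W - 1) * W⁻¹ := by rw [sub_mul, hWW, one_mul]; abel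
  -- The identity `W⁻¹ = 1 - (W - 1) W⁻¹` substituted into itself. The remainder is quadratic in `W
  -- - 1`, which gives the term `w² / (1 - w)`.
  have h2 : W⁻¹ = ((2 : ℝ) • (1 : Matrix (Fin n) (Fin n) ℝ) - W) + (W - 1) * ((W - 1) * W⁻¹) := by
    have h0 : (W - 1) * W⁻¹ = 1 - W⁻¹ := by rw [sub_mul, hWW, one_mul]
    rw [h0, mul_sub, mul_one, h0, two_smul]; abel
  have hy : ∀ k, |W⁻¹ k j| ≤ 1 / (1 - w) := by
    refine le_of_le_add_sum hw (N := fun i j => |(W - 1) i j|) (fun _ _ => abs_nonneg _) hs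
      (y := fun k => |W⁻¹ k j|) (fun _ => abs_nonneg _) fun k => ?_
    have : W⁻¹ k j = (1 : Matrix (Fin n) (Fin n) ℝ) k j - ((W - 1) * W⁻¹) k j :=
      congrFun (congrFun h1 k) j
    calc |W⁻¹ k j| ≤ |(1 : Matrix (Fin n) (Fin n) ℝ) k j| + |((W - 1) * W⁻¹) k j| := by
          rw [this]; exact abs_sub _ _
      _ ≤ _ := add_le_add (by rw [Matrix.one_apply]; split_ifs <;> simp) (abs_mul_apply_le _ _ _ _)
  have h3 : ∀ k, |((W - 1) * W⁻¹) k j| ≤ w * (1 / (1 - w)) := fun k =>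
    (abs_mul_apply_le _ _ _ _).trans
      (sum_mul_le_mul (fun _ => abs_nonneg _) (hs k) (by positivity) hy)
  have h4 : |((W - 1) * ((W - 1) * W⁻¹)) i j| ≤ w * (w * (1 / (1 - w))) :=
    (abs_mul_apply_le _ _ _ _).trans
      (sum_mul_le_mul (fun _ => abs_nonneg _) (hs i) (by positivity) h3)
  have : W⁻¹ i j = ((2 : ℝ) • (1 : Matrix (Fin n) (Fin n) ℝ) - W) i j
      + ((W - 1) * ((W - 1) * W⁻¹)) i j := congrFun (congrFun h2 i) j
  rw [this]
  refine (abs_add_le _ _).trans (add_le_add le_rfl (h4.trans (le_of_eq ?_)))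
  ring

/-- A componentwise perturbation bound for the Cholesky factor of the identity. -/
theorem abs_cholesky_sub_one_le {C E G : Matrix (Fin n) (Fin n) ℝ} {g : ℝ}
    (htri : ∀ i j, j < i → C i j = 0) (hpos : ∀ i, 0 < C i i) (hC : C.transpose * C = 1 + E)
    (hE : ∀ i j, |E i j| ≤ G i j) (hsymm : ∀ i j, G i j = G j i) (hg : g < 1)
    (hs : ∀ i, ∑ j, G i j ≤ g) (i j : Fin n) (hij : i ≤ j) :
    |(C - 1) i j| ≤ G i j + g ^ 2 / (1 - g) := by
  have hunit : IsUnit C.det := isUnit_of_upper htri fun i => (hpos i).ne'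
  have hG : ∀ i j, 0 ≤ G i j := fun i j => (abs_nonneg _).trans (hE i j)
  have hGg : ∀ i j, G i j ≤ g := fun i j =>
    (Finset.single_le_sum (f := fun j => G i j) (fun k _ => hG i k) (Finset.mem_univ j)).trans
      (hs i)
  have hg0 : 0 ≤ g := (hG i j).trans (hGg i j)
  have h1g : 0 < 1 - g := by linarith
  -- Working with `Z` makes the quadratic equation for `C` linear: in `hkey`, `Cᵀ - 1` is lower
  -- triangular and `Z` is upper triangular, so off the diagonal each entry of the left side comes
  -- from one of them.
  set Z : Matrix (Fin n) (Fin n) ℝ := 1 - C⁻¹ with hZ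
  have hCC : C * C⁻¹ = 1 := Matrix.mul_nonsing_inv C hunit
  have hkey : C.transpose - 1 + Z = E - E * Z := by
    have : C.transpose = C⁻¹ + E * C⁻¹ := by
      calc C.transpose = C.transpose * (C * C⁻¹) := by rw [hCC, mul_one]
        _ = _ := by rw [← mul_assoc, hC, add_mul, one_mul]
    rw [hZ, this, mul_sub, mul_one]; abel
  have hZlow : ∀ i j, j < i → Z i j = 0 := fun i j h => by
    rw [hZ, Matrix.sub_apply, inv_upper htri hunit h, Matrix.one_apply_ne h.ne', sub_zero]
  have hinvd : ∀ i, C⁻¹ i i = (C i i)⁻¹ := fun i => by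
    have h := congrFun (congrFun hCC i) i
    rw [Matrix.mul_apply, Matrix.one_apply_eq, Finset.sum_eq_single i] at h
    · exact eq_inv_of_mul_eq_one_right h
    · intro k _ hk
      rcases lt_or_gt_of_ne hk with hk | hk
      · rw [htri i k hk, zero_mul]
      · rw [inv_upper htri hunit hk, mul_zero]
    · simp
  have hrhs : ∀ i j, |(C.transpose - 1 + Z) i j| ≤ G i j + ∑ k, G i k * |Z k j| := fun i j => by
    rw [hkey, Matrix.sub_apply]
    refine (abs_sub _ _).trans (add_le_add (hE i j) ((abs_mul_apply_le _ _ _ _).trans ?_))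
    exact Finset.sum_le_sum fun k _ => mul_le_mul_of_nonneg_right (hE i k) (abs_nonneg _)
  -- On the diagonal the two parts are `c - 1` and `1 - 1/c` with `c > 0`. They have the same sign,
  -- so no cancellation occurs and the sum dominates each.
  have hdiag : ∀ i, |Z i i| ≤ |(C.transpose - 1 + Z) i i| ∧
      |(C.transpose - 1) i i| ≤ |(C.transpose - 1 + Z) i i| := fun i => by
    have hd := hpos i
    have e1 : Z i i = 1 - (C i i)⁻¹ := by
      rw [hZ, Matrix.sub_apply, Matrix.one_apply_eq, hinvd]
    have e2 : (C.transpose - 1) i i = C i i - 1 := by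
      rw [Matrix.sub_apply, Matrix.one_apply_eq, Matrix.transpose_apply]
    rw [Matrix.add_apply, e1, e2]
    have hi : 0 < (C i i)⁻¹ := inv_pos.2 hd
    have e3 : C i i * (C i i)⁻¹ = 1 := mul_inv_cancel₀ hd.ne'
    rcases le_total 1 (C i i) with h | h
    · have : (C i i)⁻¹ ≤ 1 := inv_le_one_of_one_le₀ h
      rw [abs_of_nonneg (by linarith), abs_of_nonneg (by linarith), abs_of_nonneg (by linarith)]
      constructor <;> linarith
    · have : 1 ≤ (C i i)⁻¹ := (one_le_inv₀ hd).2 h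
      rw [abs_of_nonpos (by linarith), abs_of_nonpos (by linarith), abs_of_nonpos (by linarith)]
      constructor <;> linarith
  have hZle : ∀ i j, |Z i j| ≤ G i j + ∑ k, G i k * |Z k j| := fun i j => by
    rcases lt_trichotomy i j with h | rfl | h
    · refine le_trans (le_of_eq ?_) (hrhs i j)
      rw [Matrix.add_apply, Matrix.sub_apply, Matrix.transpose_apply, htri j i h,
        Matrix.one_apply_ne h.ne, sub_zero, zero_add]
    · exact (hdiag i).1.trans (hrhs i i)
    · rw [hZlow i j h, abs_zero]
      exact add_nonneg (hG i j) (Finset.sum_nonneg fun k _ => mul_nonneg (hG i k) (abs_nonneg _))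
  have hXle : |(C - 1) i j| ≤ G j i + ∑ k, G j k * |Z k i| := by
    have e : (C - 1) i j = (C.transpose - 1) j i := by
      simp [Matrix.sub_apply, Matrix.one_apply, eq_comm]
    rw [e]
    rcases hij.lt_or_eq with h | rfl
    · refine le_trans (le_of_eq ?_) (hrhs j i)
      rw [Matrix.add_apply, hZlow j i h, add_zero]
    · exact (hdiag i).2.trans (hrhs i i)
  -- Column `i` of `|Z|` satisfies `y ≤ g + G y`. One more multiplication by `G`, whose row sums are
  -- at most `g`, yields `g² / (1 - g)`.
  have hZg : ∀ k, |Z k i| ≤ g / (1 - g) :=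
    le_of_le_add_sum hg hG hs (fun _ => abs_nonneg _) fun k =>
      (hZle k i).trans (add_le_add (hGg k i) le_rfl)
  rw [hsymm i j]
  refine hXle.trans (add_le_add le_rfl ?_)
  refine (sum_mul_le_mul (hG j) (hs j) (by positivity) hZg).trans (le_of_eq ?_)
  ring

/-- The perturbation bound for the Gram matrix of `M` around a midpoint. -/
theorem abs_gram_sub_le {M m r : Matrix (Fin n) (Fin n) ℝ} {i j : Fin n} (δ : ℝ)
    (h : ∀ k, |M k i - m k i| ≤ r k i) (h' : ∀ k, |M k j - m k j| ≤ r k j) :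
    |∑ k, M k i * M k j - δ| ≤ |∑ k, m k i * m k j - δ| + ∑ k, |m k i| * r k j
      + ∑ k, r k i * (|m k j| + r k j) := by
  -- With `d = M - m`, each product splits as `mᵢ mⱼ + mᵢ dⱼ + dᵢ (mⱼ + dⱼ)`, matching the three
  -- computed terms.
  have e : ∑ k, M k i * M k j - δ = (∑ k, m k i * m k j - δ)
      + ∑ k, m k i * (M k j - m k j) + ∑ k, (M k i - m k i) * (m k j + (M k j - m k j)) := by
    rw [add_assoc, ← Finset.sum_add_distrib, sub_add_eq_add_sub, ← Finset.sum_add_distrib]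
    congr 1
    exact Finset.sum_congr rfl fun k _ => by ring
  rw [e]
  refine (abs_add_le _ _).trans (add_le_add ((abs_add_le _ _).trans (add_le_add le_rfl ?_)) ?_)
  · refine (Finset.abs_sum_le_sum_abs _ _).trans (Finset.sum_le_sum fun k _ => ?_)
    rw [abs_mul]
    exact mul_le_mul_of_nonneg_left (h' k) (abs_nonneg _)
  · refine (Finset.abs_sum_le_sum_abs _ _).trans (Finset.sum_le_sum fun k _ => ?_)
    rw [abs_mul]
    exact mul_le_mul (h k) ((abs_add_le _ _).trans (add_le_add le_rfl (h' k))) (abs_nonneg _)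
      ((abs_nonneg _).trans (h k))

theorem foldlM_tick_val {α ι : Type} (ks : List ι) (f : α → ι → α) (a : α) :
    (ks.foldlM (fun acc k => tick (f acc k)) a).val = ks.foldl f a := by
  induction ks generalizing a with
  | nil => rfl
  | cons k ks ih => exact ih _

/-! ### The scalar bounds -/

/-- The exponent is `prec` itself, admissible because `prec ≤ emax`. -/
theorem Format.rep_of_nat (fmt : Format) {k : ℕ} (hk : k < 2 ^ fmt.prec) :
    fmt.IsRep ((k : ℝ) * 2) := by
  have := fmt.two_le_prec
  have := fmt.prec_le_emax
  refine ⟨k, fmt.prec, by rw [abs_of_nonneg (by positivity)]; exact_mod_cast hk,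
    by unfold Format.emin; lia, by lia, ?_⟩
  rw [sub_sub_cancel, zpow_one, Int.cast_natCast]

theorem Format.rep_two_pow (fmt : Format) : fmt.IsRep ((2 : ℝ) ^ fmt.prec) := by
  have h := fmt.two_le_prec
  have h1 := fmt.rep_of_nat (k := 2 ^ (fmt.prec - 1))
    (pow_lt_pow_right₀ (by norm_num) (by lia))
  obtain ⟨p, hp⟩ : ∃ p, fmt.prec = p + 1 := ⟨fmt.prec - 1, by lia⟩
  rw [hp] at h1 ⊢
  rw [pow_succ]
  simpa using h1

/-- Serves to show that the entries of `H` do not overflow. The witness is `3 * 2 ^ (prec - 1)`. -/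
theorem Format.exists_rep_ge (fmt : Format) : ∃ y, fmt.IsRep y ∧ 1 + (2 : ℝ) ^ fmt.prec ≤ y := by
  have h := fmt.two_le_prec
  obtain ⟨p, hp⟩ : ∃ p, fmt.prec = p + 2 := ⟨fmt.prec - 2, by lia⟩
  have h2 : 1 ≤ 2 ^ p := Nat.one_le_two_pow
  refine ⟨_, fmt.rep_of_nat (k := 3 * 2 ^ p) ?_, ?_⟩
  · rw [hp, pow_add]; lia
  · have h2 : (1 : ℝ) ≤ 2 ^ p := by exact_mod_cast h2
    rw [hp, pow_add]
    push_cast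
    linarith

/-- The gap just below `1` is `2 ^ (-prec)`, so a passed test `g < 1` keeps `1 - g` quantitatively
away from zero. -/
theorem Format.IsRep.le_of_lt_one {fmt : Format} {x : ℝ} (h : fmt.IsRep x) (hx : x < 1) :
    x ≤ 1 - ((2 : ℝ) ^ fmt.prec)⁻¹ := by
  obtain ⟨m, e, hm, -, -, rfl⟩ := h
  have hP : (0 : ℝ) < 2 ^ fmt.prec := by positivity
  -- In units of `2 ^ (-prec)` the number is `m * 2 ^ (e + 1)`: an integer if `e + 1 ≥ 0`, and
  -- otherwise at most `max m 0`, which is below `2 ^ prec`.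
  have key : ∃ K : ℤ, K < 2 ^ fmt.prec ∧
      (m : ℝ) * (2 : ℝ) ^ (e - ((fmt.prec : ℤ) - 1)) ≤ K * ((2 : ℝ) ^ fmt.prec)⁻¹ := by
    have e1 : (2 : ℝ) ^ (e - ((fmt.prec : ℤ) - 1)) = 2 ^ (e + 1) * ((2 : ℝ) ^ fmt.prec)⁻¹ := by
      rw [← zpow_natCast, ← zpow_neg, ← zpow_add₀ (by norm_num)]
      congr 1; ring
    rcases le_or_gt 0 (e + 1) with he | he
    · obtain ⟨k, hk⟩ := Int.eq_ofNat_of_zero_le he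
      have e2 : (m : ℝ) * (2 : ℝ) ^ (e - ((fmt.prec : ℤ) - 1))
          = ((m * 2 ^ k : ℤ) : ℝ) * ((2 : ℝ) ^ fmt.prec)⁻¹ := by
        rw [e1, hk, zpow_natCast]; push_cast; ring
      refine ⟨m * 2 ^ k, ?_, e2.le⟩
      rw [e2, ← div_eq_mul_inv, div_lt_one hP] at hx
      exact_mod_cast hx
    · refine ⟨max m 0, max_lt (lt_of_le_of_lt (le_abs_self m) hm) (by positivity), ?_⟩
      rw [e1, ← mul_assoc]
      refine mul_le_mul_of_nonneg_right ?_ (by positivity)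
      have h1 : (2 : ℝ) ^ (e + 1) ≤ 1 := zpow_le_one_of_nonpos₀ (by norm_num) he.le
      have h2 : (m : ℝ) ≤ ((max m 0 : ℤ) : ℝ) := by exact_mod_cast le_max_left m 0
      have h3 : (0 : ℝ) ≤ ((max m 0 : ℤ) : ℝ) := by exact_mod_cast le_max_right m 0
      calc (m : ℝ) * 2 ^ (e + 1) ≤ ((max m 0 : ℤ) : ℝ) * 2 ^ (e + 1) :=
            mul_le_mul_of_nonneg_right h2 (by positivity)
        _ ≤ _ := mul_le_of_le_one_right h3 h1
  obtain ⟨K, hK, hle⟩ := key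
  refine hle.trans ?_
  have : (K : ℝ) ≤ 2 ^ fmt.prec - 1 := by exact_mod_cast Int.le_sub_one_of_lt hK
  calc (K : ℝ) * ((2 : ℝ) ^ fmt.prec)⁻¹ ≤ (2 ^ fmt.prec - 1) * ((2 : ℝ) ^ fmt.prec)⁻¹ :=
        mul_le_mul_of_nonneg_right this (by positivity)
    _ = _ := by rw [sub_mul, mul_inv_cancel₀ hP.ne', one_mul]

open Fl

/-- Since `1 - g ≥ 2 ^ (-prec)` and this number is representable, the rounded denominator is no
smaller, its rounded reciprocal is at most `2 ^ prec`, and the rounded square is at most `1`. Hence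
no step overflows. -/
theorem tailBound_spec {g : Fl fmt} (hg : g.IsFinite) (h0 : 0 ≤ g.toReal) (h1 : g.toReal < 1) :
    (tailBound g).val.IsFinite ∧ g.toReal ^ 2 / (1 - g.toReal) ≤ (tailBound g).val.toReal ∧
      (tailBound g).val.toReal ≤ 2 ^ fmt.prec := by
  have hP : (0 : ℝ) < 2 ^ fmt.prec := by positivity
  have h1g : 0 < 1 - g.toReal := by linarith
  change (mul .up (mul .up g g) (div .up one (neg (sub .up g one)))).IsFinite ∧
    _ ≤ (mul .up (mul .up g g) (div .up one (neg (sub .up g one)))).toReal ∧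
    (mul .up (mul .up g g) (div .up one (neg (sub .up g one)))).toReal ≤ _
  obtain ⟨s, hd⟩ := add_up_eq hg (isFinite_neg.2 isFinite_one)
  have hdr := roundUp_le_rep (fmt := fmt) s (z := g.toReal + (neg (one : Fl fmt)).toReal)
    -- This is `-2 ^ (-prec)`, with significand `1` and exponent `-1` up to sign.
    (y := -(1 - (1 - ((2 : ℝ) ^ fmt.prec)⁻¹))) ?_ ?_
  rotate_left
  · refine Format.IsRep.neg ⟨1, -1, ?_, ?_, ?_, ?_⟩
    · rw [abs_one]; exact one_lt_pow₀ (by norm_num) (by have := fmt.two_le_prec; lia)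
    · have := fmt.two_le_prec
      have := fmt.prec_le_emax
      unfold Format.emin; lia
    · lia
    · rw [sub_sub_cancel, ← zpow_natCast, ← zpow_neg, Int.cast_one, one_mul]
      congr 1; ring
  · rw [toReal_neg, toReal_one]
    have := (isRep_toReal g).le_of_lt_one h1
    linarith
  have hdl := above_sub hg (isFinite_one (fmt := fmt))
  rw [← hd] at hdr
  change (sub .up g one).IsFinite ∧ (sub .up g one).toReal ≤ _ at hdr
  generalize sub .up g one = d at hdr hdl ⊢
  have hdl := hdl.le hdr.1
  have hdu := hdr.2
  rw [toReal_one] at hdl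
  rw [sub_sub_cancel] at hdu
  have ht := isFinite_neg.2 hdr.1
  have htr := toReal_neg d
  generalize neg d = t at ht htr ⊢
  have hPi : (0 : ℝ) < ((2 : ℝ) ^ fmt.prec)⁻¹ := by positivity
  have htpos : 0 < t.toReal := by linarith
  obtain ⟨s', hq⟩ := div_up_eq isFinite_one ht htpos.ne'
  rw [toReal_one] at hq
  have hqr := roundUp_le_rep s' (z := 1 / t.toReal) fmt.rep_two_pow (by
    rw [div_le_iff₀ htpos]
    have : (2 : ℝ) ^ fmt.prec * ((2 : ℝ) ^ fmt.prec)⁻¹ = 1 := mul_inv_cancel₀ hP.ne'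
    nlinarith)
  have hql := (above_roundUp s' (1 / t.toReal)).le hqr.1
  rw [← hq] at hqr hql
  have hql : 1 / (1 - g.toReal) ≤ (div .up one t).toReal :=
    (one_div_le_one_div_of_le htpos (by linarith)).trans hql
  generalize div .up one t = q at hqr hql ⊢
  obtain ⟨s'', hs⟩ := mul_up_eq hg hg
  have hsr := roundUp_le_rep s'' (z := g.toReal * g.toReal) fmt.rep_one (by nlinarith)
  rw [← hs] at hsr
  have hsl := (above_mul hg hg).le hsr.1
  generalize mul .up g g = sq at hsr hsl ⊢
  obtain ⟨s3, h3⟩ := mul_up_eq hsr.1 hqr.1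
  have hq0 : 0 ≤ 1 / (1 - g.toReal) := by positivity
  have hsq0 : 0 ≤ sq.toReal := (mul_nonneg h0 h0).trans hsl
  have h3r := roundUp_le_rep s3 (z := sq.toReal * q.toReal) fmt.rep_two_pow (by
    have : sq.toReal * q.toReal ≤ 1 * 2 ^ fmt.prec :=
      mul_le_mul hsr.2 hqr.2 (hq0.trans hql) zero_le_one
    linarith)
  rw [← h3] at h3r
  refine ⟨h3r.1, ?_, h3r.2⟩
  refine le_trans ?_ ((above_mul hsr.1 hqr.1).le h3r.1)
  rw [pow_two, div_eq_mul_one_div]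
  exact mul_le_mul hsl hql hq0 hsq0

theorem nonneg_absSub (lo hi c : Fl fmt) : (absSub lo hi c).val.Nonneg :=
  (nonneg_abs (sub .down lo c)).max (nonneg_abs (sub .up hi c))

/-- The modulus on an interval is largest at an endpoint. Finiteness of the result also certifies
both endpoints. -/
theorem absSub_spec {lo hi c : Fl fmt} (h : (absSub lo hi c).val.IsFinite) :
    lo.IsFinite ∧ hi.IsFinite ∧ ∀ x, lo.toReal ≤ x → x ≤ hi.toReal →
      |x - c.toReal| ≤ (absSub lo hi c).val.toReal := by
  change (Fl.max (Fl.abs (sub .down lo c)) (Fl.abs (sub .up hi c))).IsFinite at h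
  obtain ⟨h1, h2⟩ := (nonneg_abs _).isFinite_of_max (nonneg_abs _) h
  have h1' := isFinite_abs.1 h1
  have h2' := isFinite_abs.1 h2
  refine ⟨(isFinite_of_sub h1').1, (isFinite_of_sub h2').1, fun x hx hx' => ?_⟩
  change _ ≤ (Fl.max (Fl.abs (sub .down lo c)) (Fl.abs (sub .up hi c))).toReal
  rw [(max_eq_of_isFinite h1 h2).2, toReal_abs, toReal_abs]
  have := sub_down_le h1'
  have := sub_up_ge h2'
  exact abs_le_max_abs_abs (by linarith) (by linarith)

theorem normInf_val (M : FMat fmt n) : (normInf M).val =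
    (allIdx n).foldl (fun acc i => Fl.max acc
      ((allIdx n).foldl (fun acc j => Fl.add .up acc (M i j)) (Fl.zero false))) (Fl.zero false) := by
  have h : (normInf M).val = (allIdx n).foldl (fun acc i => Fl.max acc
      ((allIdx n).foldlM (fun acc j => fadd .up acc (M i j)) (Fl.zero false)).val)
        (Fl.zero false) := foldlM_tick_val _ _ _
  rw [h]
  congr 1
  funext acc i
  exact congrArg _ (foldlM_tick_val (allIdx n) (fun acc j => Fl.add .up acc (M i j)) _)

theorem nonneg_foldl_max {ι : Type} (ks : List ι) (f : ι → Fl fmt) (hf : ∀ k, (f k).Nonneg)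
    (a : Fl fmt) (ha : a.Nonneg) : (ks.foldl (fun acc k => Fl.max acc (f k)) a).Nonneg := by
  induction ks generalizing a with
  | nil => exact ha
  | cons k ks ih => exact ih _ (ha.max (hf k))

theorem foldl_max_spec {ι : Type} (ks : List ι) (f : ι → Fl fmt) (hf : ∀ k, (f k).Nonneg)
    (a : Fl fmt) (ha : a.Nonneg) (h : (ks.foldl (fun acc k => Fl.max acc (f k)) a).IsFinite) :
    (a.IsFinite ∧ a.toReal ≤ (ks.foldl (fun acc k => Fl.max acc (f k)) a).toReal) ∧
    ∀ k ∈ ks, (f k).IsFinite ∧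
      (f k).toReal ≤ (ks.foldl (fun acc k => Fl.max acc (f k)) a).toReal := by
  induction ks generalizing a with
  | nil => exact ⟨⟨h, le_rfl⟩, by simp⟩
  | cons k ks ih =>
    obtain ⟨⟨h1, h2⟩, h3⟩ := ih _ (ha.max (hf k)) h
    obtain ⟨ha', hk'⟩ := ha.isFinite_of_max (hf k) h1
    have hm := (max_eq_of_isFinite ha' hk').2
    rw [hm] at h2
    refine ⟨⟨ha', le_sup_left.trans h2⟩, fun l hl => ?_⟩
    rcases List.mem_cons.1 hl with rfl | hl
    · exact ⟨hk', le_sup_right.trans h2⟩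
    · exact h3 l hl

theorem nonneg_normInf {M : FMat fmt n} (hM : ∀ i j, (M i j).Nonneg) : (normInf M).val.Nonneg := by
  rw [normInf_val]
  exact nonneg_foldl_max _ _
    (fun i => nonneg_foldl_add _ _ (fun j _ => hM i j) _ (nonneg_zero _)) _ (nonneg_zero _)

theorem normInf_spec {M : FMat fmt n} (hM : ∀ i j, (M i j).Nonneg)
    (h : (normInf M).val.IsFinite) (i : Fin n) :
    (∀ j, (M i j).IsFinite) ∧ ∑ j, (M i j).toReal ≤ (normInf M).val.toReal := by
  rw [normInf_val] at h ⊢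
  obtain ⟨h1, h2⟩ := (foldl_max_spec _ _
    (fun i => nonneg_foldl_add (allIdx n) (M i) (fun j _ => hM i j) _ (nonneg_zero _)) _
    (nonneg_zero _) h).2 i (mem_allIdx i)
  have hfin := (isFinite_of_foldl_add (allIdx n) (M i) _ h1).2
  refine ⟨fun j => hfin j (mem_allIdx j), le_trans ?_ h2⟩
  have := (above_foldl_add (allIdx n) (M i) (fun j => (M i j).toReal)
    (fun j hj => Or.inr ⟨hfin j hj, le_rfl⟩) _ 0 (above_zero false)).le h1
  rw [zero_add, sum_map_eq_sum_ite (nodup_allIdx n)] at this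
  simpa [mem_allIdx] using this

/-! ### Midpoint and radius -/

/-- The upward rounded midpoint of an interval. -/
noncomputable def midpoint (lo hi : Fl fmt) : Fl fmt := div .up (add .up hi lo) two

/-- The upward rounded radius of an interval with respect to its midpoint. -/
noncomputable def radius (lo hi : Fl fmt) : Fl fmt := sub .up (midpoint lo hi) lo

theorem Fl.Above.div_two {a : Fl fmt} {x : ℝ} (h : a.Above x) :
    (div .up a two).Above (x / 2) := by
  rcases h with rfl | ⟨ha, hx⟩
  · left; simp [div, IsFinite, two, sign]
  · obtain ⟨s, hs⟩ := div_up_eq ha isFinite_two two_ne_zero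
    rw [hs, toReal_two]
    exact (above_roundUp _ _).mono (by linarith)

theorem Fl.Above.sub {a b : Fl fmt} {x y : ℝ} (h : a.Above x) (hb : b.IsFinite)
    (hy : b.toReal ≤ y) : (sub .up a b).Above (x - y) := by
  rw [sub_eq_add_neg]
  exact h.add (Or.inr ⟨isFinite_neg.2 hb, by rw [toReal_neg]; linarith⟩)

/-- The enclosed `x` guarantees `lo ≤ hi`, and upward rounding keeps the midpoint above `lo`. For
`lo = -∞` the midpoint is `-∞` or NaN, and subtracting `lo` gives NaN. -/
theorem nonneg_radius {lo hi : Fl fmt} {x : ℝ} (hlo : lo.Below x) (hhi : hi.Above x) :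
    (radius lo hi).Nonneg := by
  rcases hlo with rfl | ⟨hlo, hx⟩
  · left
    rcases hhi with rfl | ⟨hhi, -⟩
    · simp [radius, midpoint, Fl.add, div, Fl.sub, IsFinite, neg]
    · cases hi <;>
        simp_all [radius, midpoint, Fl.add, div, Fl.sub, IsFinite, neg, two, sign]
  · right
    have h1 : hi.Above lo.toReal := hhi.mono hx
    have h2 : (midpoint lo hi).Above ((lo.toReal + lo.toReal) / 2) :=
      (h1.add (Or.inr ⟨hlo, le_rfl⟩)).div_two
    exact (h2.sub hlo le_rfl).mono (by linarith)

/-- The radius is measured from `lo`. It also reaches `hi`, because the midpoint is rounded upwards: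
`mid + rad ≥ 2 mid - lo ≥ hi`. -/
theorem abs_sub_midpoint_le {lo hi : Fl fmt} {x : ℝ} (hlo : lo.Below x) (hhi : hi.Above x)
    (h : (radius lo hi).IsFinite) : |x - (midpoint lo hi).toReal| ≤ (radius lo hi).toReal := by
  have h1 := isFinite_of_sub h
  have h2 := isFinite_of_add (isFinite_of_div_two h1.1)
  have h3 := add_up_ge (isFinite_of_div_two h1.1)
  have h4 := div_two_ge h1.1
  have h5 := sub_up_ge h
  have h6 := hlo.le h1.2
  have h7 := hhi.le h2.1
  change _ ≤ (midpoint lo hi).toReal at h4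
  change _ ≤ (radius lo hi).toReal at h5
  exact abs_le.2 ⟨by linarith, by linarith⟩

theorem gramBound_val (range : Fin n → List (Fin n)) (lo hi : FMat fmt n) (i j : Fin n) :
    (gramBound range lo hi).val i j =
      let mid : FMat fmt n := fun i j => midpoint (lo i j) (hi i j)
      let rad : FMat fmt n := fun i j => radius (lo i j) (hi i j)
      let entry : Fin n → Fin n → Fl fmt := fun i j =>
        add .up (add .up
          (absSub (dot .down (range i) (fun k => mid k i) (fun k => mid k j)).val
            (dot .up (range i) (fun k => mid k i) (fun k => mid k j)).val
            (scalarEntry one i j)).val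
          (dot .up (range i) (fun k => Fl.abs (mid k i)) (fun k => rad k j)).val)
          (dot .up (range i) (fun k => rad k i)
            (fun k => add .up (Fl.abs (mid k j)) (rad k j))).val
      if i ≤ j then entry i j else entry j i := by
  have key : ∀ i j : Fin n, i ≤ j → (gramBound range lo hi).val i j = _ :=
    fun i j hij => (symmetric_val _ i j).trans (if_pos hij)
  have key' : ∀ i j : Fin n, ¬ i ≤ j → (gramBound range lo hi).val i j = _ :=
    fun i j hij => (symmetric_val _ i j).trans (if_neg hij)
  dsimp only
  by_cases hij : i ≤ j
  · rw [if_pos hij]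
    refine (key i j hij).trans ?_
    change add .up (add .up (absSub ((upper _).val i j) ((upper _).val i j) _).val
      ((upper _).val i j)) ((upper _).val i j) = _
    simp only [upper_val, if_pos hij]
    rfl
  · rw [if_neg hij]
    refine (key' i j hij).trans ?_
    change add .up (add .up (absSub ((upper _).val j i) ((upper _).val j i) _).val
      ((upper _).val j i)) ((upper _).val j i) = _
    simp only [upper_val, if_pos (le_of_not_ge hij)]
    rfl

theorem gramBound_comm (range : Fin n → List (Fin n)) (lo hi : FMat fmt n) (i j : Fin n) :
    (gramBound range lo hi).val i j = (gramBound range lo hi).val j i := by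
  rcases lt_trichotomy i j with h | rfl | h
  · rw [gramBound_val, gramBound_val]
    simp [h.le, not_le.2 h]
  · rfl
  · rw [gramBound_val, gramBound_val]
    simp [h.le, not_le.2 h]

theorem nonneg_gramBound {range : Fin n → List (Fin n)} {lo hi : FMat fmt n}
    {M : Matrix (Fin n) (Fin n) ℝ} (hlo : ∀ i j, (lo i j).Below (M i j))
    (hhi : ∀ i j, (hi i j).Above (M i j)) (i j : Fin n) :
    ((gramBound range lo hi).val i j).Nonneg := by
  have hr : ∀ i j, (radius (lo i j) (hi i j)).Nonneg := fun i j =>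
    nonneg_radius (hlo i j) (hhi i j)
  rw [gramBound_val]
  dsimp only
  have key : ∀ i j : Fin n, Fl.Nonneg _ := fun i j =>
    (((nonneg_absSub (dot .down (range i) (fun k => midpoint (lo k i) (hi k i))
        (fun k => midpoint (lo k j) (hi k j))).val
      (dot .up (range i) (fun k => midpoint (lo k i) (hi k i))
        (fun k => midpoint (lo k j) (hi k j))).val (scalarEntry one i j)).add
      (nonneg_dot (ks := range i) fun k _ =>
        ⟨nonneg_abs (midpoint (lo k i) (hi k i)), hr k j⟩)).add
      (nonneg_dot (ks := range i) fun k _ =>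
        ⟨hr k i, (nonneg_abs (midpoint (lo k j) (hi k j))).add (hr k j)⟩))
  split_ifs
  · exact key i j
  · exact key j i

theorem scalarEntry_toReal (c : Fl fmt) (i j : Fin n) :
    (scalarEntry c i j).toReal = (c.toReal • (1 : Matrix (Fin n) (Fin n) ℝ)) i j := by
  unfold scalarEntry
  rw [Matrix.smul_apply, Matrix.one_apply]
  split_ifs <;> simp [toReal]

theorem gramBound_spec {range : Fin n → List (Fin n)} {lo hi : FMat fmt n}
    {M : Matrix (Fin n) (Fin n) ℝ} (hlo : ∀ i j, (lo i j).Below (M i j))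
    (hhi : ∀ i j, (hi i j).Above (M i j)) (hnd : ∀ i, (range i).Nodup)
    (hM : ∀ i k, k ∉ range i → M k i = 0)
    (hfin : ∀ i j, ((gramBound range lo hi).val i j).IsFinite) (i j : Fin n) :
    |(M.transpose * M - 1) i j| ≤ ((gramBound range lo hi).val i j).toReal := by
  have key : ∀ i j : Fin n, i ≤ j →
      |(M.transpose * M - 1) i j| ≤ ((gramBound range lo hi).val i j).toReal := by
    intro i j hij
    have hf := hfin i j
    rw [gramBound_val] at hf ⊢
    simp only [if_pos hij] at hf ⊢
    have h1 := isFinite_of_add hf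
    have h2 := isFinite_of_add h1.1
    obtain ⟨h3, h4, h5⟩ := absSub_spec h2.1
    have hP := isFinite_of_dot h2.2
    have hQ := isFinite_of_dot h1.2
    have g1 := add_up_ge hf
    have g2 := add_up_ge h1.1
    have hr : ∀ l, (∀ k ∈ range i, (radius (lo k l) (hi k l)).IsFinite) → ∀ k ∈ range i,
        |M k l - (midpoint (lo k l) (hi k l)).toReal| ≤ (radius (lo k l) (hi k l)).toReal :=
      fun l h k hk => abs_sub_midpoint_le (hlo k l) (hhi k l) (h k hk)
    have hri := hr i fun k hk => (hQ k hk).1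
    have hrj := hr j fun k hk => (hP k hk).2
    -- Truncating rows to `range i` leaves the sum of products unchanged, because column `i` of `M`
    -- vanishes elsewhere. Outside the range the radii are not known to be finite.
    let Mr : Matrix (Fin n) (Fin n) ℝ := fun k l => if k ∈ range i then M k l else 0
    let m : Matrix (Fin n) (Fin n) ℝ := fun k l =>
      if k ∈ range i then (midpoint (lo k l) (hi k l)).toReal else 0
    let r : Matrix (Fin n) (Fin n) ℝ := fun k l =>
      if k ∈ range i then (radius (lo k l) (hi k l)).toReal else 0
    have hb := abs_gram_sub_le (M := Mr) (m := m) (r := r) (i := i) (j := j)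
      (scalarEntry (one : Fl fmt) i j).toReal
      (fun k => by
        by_cases hk : k ∈ range i
        · simpa [Mr, m, r, hk] using hri k hk
        · simp [Mr, m, r, hk])
      (fun k => by
        by_cases hk : k ∈ range i
        · simpa [Mr, m, r, hk] using hrj k hk
        · simp [Mr, m, r, hk])
    have hMr : ∑ k, Mr k i * Mr k j = ∑ k, M k i * M k j :=
      Finset.sum_congr rfl fun k _ => by
        by_cases hk : k ∈ range i
        · simp [Mr, hk]
        · simp [Mr, hk, hM i k hk]
    rw [hMr] at hb
    have hL : (M.transpose * M - 1) i j
        = ∑ k, M k i * M k j - (scalarEntry (one : Fl fmt) i j).toReal := by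
      rw [scalarEntry_toReal, toReal_one, one_smul, Matrix.sub_apply, Matrix.mul_apply]
      rfl
    rw [hL]
    refine hb.trans ?_
    have b1 := h5 (∑ k, m k i * m k j)
      (dot_down_le (hnd i) h3 (fun k hk => by simp [m, hk]) (fun k hk => by simp [m, hk]))
      (le_dot_up (hnd i) h4 (fun k hk => by simp [m, hk]) (fun k hk => by simp [m, hk]))
    have b2 : ∑ k, |m k i| * r k j ≤ _ := le_dot_up (hnd i) h2.2
      (fun k hk => by simp [m, r, hk, toReal_abs]) (fun k hk => by simp [m, hk])
    have b3 : ∑ k, r k i * (|m k j| + r k j) ≤ _ := le_dot_up (hnd i) h1.2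
      (fun k hk => by
        have h7 := add_up_ge (hQ k hk).2
        rw [toReal_abs] at h7
        have h8 := (abs_nonneg _).trans (hri k hk)
        simpa [m, r, hk] using mul_le_mul_of_nonneg_left h7 h8)
      (fun k hk => by simp [r, hk])
    linarith
  rcases le_total i j with hij | hij
  · exact key i j hij
  · have h := key j i hij
    have e1 : (M.transpose * M - 1) i j = (M.transpose * M - 1) j i := by
      simp only [Matrix.sub_apply, Matrix.mul_apply, Matrix.transpose_apply, Matrix.one_apply,
        mul_comm (M _ i), eq_comm (a := i)]
    rw [e1, gramBound_comm]
    exact h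

/-! ### Operation counts -/

theorem foldlM_cost {α ι : Type} (ks : List ι) (f : α → ι → Counted α) (c : ι → ℕ)
    (h : ∀ a k, (f a k).cost = c k) (a : α) : (ks.foldlM f a).cost = (ks.map c).sum := by
  induction ks generalizing a with
  | nil => rfl
  | cons k ks ih =>
    change (f a k).cost + (ks.foldlM f (f a k).val).cost = _
    rw [ih, h, List.map_cons, List.sum_cons]

theorem dot_cost (m : Mode) (ks : List (Fin n)) (u v : Fin n → Fl fmt) :
    (dot m ks u v).cost = 2 * ks.length := by
  unfold dot
  rw [foldlM_cost ks _ (fun _ => 2) (fun _ _ => rfl)]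
  simp [mul_comm]

theorem length_allIdx : (allIdx n).length = n := List.length_finRange

theorem length_filter_finRange (p : Fin n → Bool) :
    ((List.finRange n).filter p).length = (Finset.univ.filter fun k => p k = true).card := by
  rw [← List.toFinset_card_of_nodup ((List.nodup_finRange n).filter p)]
  congr 1
  ext k
  simp

theorem length_idxLE (j : Fin n) : ((idxLE j).length : ℤ) = j + 1 := by
  have : (Finset.univ.filter fun k : Fin n => decide (k ≤ j) = true) = Finset.Iic j := by
    ext k; simp
  rw [idxLE, length_filter_finRange, this, Fin.card_Iic]
  push_cast; ring

theorem length_idxIcc {i j : Fin n} (h : i ≤ j) : ((idxIcc i j).length : ℤ) = j + 1 - i := by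
  have : (Finset.univ.filter fun k : Fin n => decide (i ≤ k ∧ k ≤ j) = true) = Finset.Icc i j := by
    ext k; simp
  have h' : (i : ℕ) ≤ j := h
  rw [idxIcc, length_filter_finRange, this, Fin.card_Icc]
  lia

theorem length_idxIoc {i j : Fin n} (h : i ≤ j) : ((idxIoc i j).length : ℤ) = j - i := by
  have : (Finset.univ.filter fun k : Fin n => decide (i < k ∧ k ≤ j) = true) = Finset.Ioc i j := by
    ext k; simp
  have h' : (i : ℕ) ≤ j := h
  rw [idxIoc, length_filter_finRange, this, Fin.card_Ioc]
  lia

theorem sum_upper_eq (f : ℕ → ℕ → ℤ) (n : ℕ) :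
    ∑ i : Fin n, ∑ j : Fin n, (if i ≤ j then f i j else 0) =
      ∑ j ∈ Finset.range n, ∑ i ∈ Finset.range (j + 1), f i j := by
  induction n with
  | zero => simp
  | succ n ih =>
    rw [Fin.sum_univ_castSucc, Finset.sum_range_succ, ← ih]
    simp only [Fin.sum_univ_castSucc, Finset.sum_add_distrib, Fin.castSucc_le_castSucc_iff,
      Fin.le_last, if_true, Fin.val_castSucc, Fin.val_last, not_le.2 (Fin.castSucc_lt_last _),
      if_false, Finset.sum_const_zero, zero_add, Finset.sum_range_succ _ n, le_refl, add_assoc]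
    rw [Finset.sum_range (fun i => f i n)]

/-- The factor `6` clears the denominators of the sums; all counts below are stated as six times the
cost. -/
theorem sum_upper_linear (a b c : ℤ) (n : ℕ) :
    6 * ∑ i : Fin n, ∑ j : Fin n, (if i ≤ j then a * (i : ℤ) + b * (j : ℤ) + c else 0) =
      (a + 2 * b) * ((n - 1) * n * (n + 1)) + 3 * c * (n * (n + 1)) := by
  rw [sum_upper_eq fun i j => a * (i : ℤ) + b * (j : ℤ) + c]
  have inner : ∀ j m : ℕ, 2 * ∑ i ∈ Finset.range m, (a * (i : ℤ) + b * (j : ℤ) + c) =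
      m * (a * (m - 1) + 2 * b * j + 2 * c) := by
    intro j m
    induction m with
    | zero => simp
    | succ m ih => rw [Finset.sum_range_succ, mul_add, ih]; push_cast; ring
  induction n with
  | zero => simp
  | succ n ih =>
    rw [Finset.sum_range_succ, mul_add, ih]
    have := inner n (n + 1)
    push_cast at this ⊢
    linear_combination 3 * this

/-- The continuation must cost the same for every value, so that costs of consecutive steps add
without computing any value. -/
theorem bind_cost {α β : Type} {x : Counted α} {f : α → Counted β} {a b : ℤ}
    (hx : 6 * (x.cost : ℤ) = a) (hf : ∀ v, 6 * ((f v).cost : ℤ) = b) :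
    6 * ((x >>= f).cost : ℤ) = a + b := by
  change 6 * ((x.cost + (f x.val).cost : ℕ) : ℤ) = _
  rw [Nat.cast_add, mul_add, hx, hf]

theorem pure_cost {α : Type} (x : α) : 6 * ((pure x : Counted α).cost : ℤ) = 0 := rfl

theorem matrix_cost_const {f : Fin n → Fin n → Counted (Fl fmt)} {c : ℕ}
    (h : ∀ i j, (f i j).cost = c) : 6 * ((matrix f).cost : ℤ) = 6 * c * n ^ 2 := by
  change 6 * ((∑ i, ∑ j, (f i j).cost : ℕ) : ℤ) = _
  simp only [h, Finset.sum_const, Finset.card_univ, Fintype.card_fin, smul_eq_mul]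
  push_cast; ring

theorem upper_cost_linear {f : Fin n → Fin n → Counted (Fl fmt)} (a b c : ℤ)
    (h : ∀ i j, i ≤ j → ((f i j).cost : ℤ) = a * i + b * j + c) :
    6 * ((upper f).cost : ℤ) =
      (a + 2 * b) * ((n - 1) * n * (n + 1)) + 3 * c * (n * (n + 1)) := by
  rw [← sum_upper_linear]
  change 6 * ((∑ i, ∑ j, (if i ≤ j then f i j else pure (Fl.zero false)).cost : ℕ) : ℤ) = _
  push_cast
  congr 1
  refine Finset.sum_congr rfl fun i _ => Finset.sum_congr rfl fun j _ => ?_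
  split_ifs with hij
  · exact h i j hij
  · rfl

theorem symmetric_cost (f : Fin n → Fin n → Counted (Fl fmt)) :
    (symmetric f).cost = (upper f).cost := rfl

theorem triInverse_cost (mode : Mode) (R : FMat fmt n) :
    6 * ((triInverse mode R).cost : ℤ) = 2 * ((n - 1) * n * (n + 1)) + 6 * (n * (n + 1)) - 6 * n := by
  have h : (triInverse mode R).cost = ∑ i : Fin n, ∑ j : Fin n,
      if j < i then 0 else if j = i then 1 else 2 * (idxIoc i j).length + 2 := by
    refine (foldlM_cost _ _ (fun i : Fin n => ∑ j : Fin n,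
      if j < i then 0 else if j = i then 1 else 2 * (idxIoc i j).length + 2) ?_ _).trans ?_
    rotate_left
    · rw [List.map_reverse, List.sum_reverse, Fin.sum_univ_def]
    · intro V i
      change (∑ j : Fin n, Counted.cost (_)) + 0 = _
      rw [add_zero]
      refine Finset.sum_congr rfl fun j _ => ?_
      split_ifs
      · rfl
      · rfl
      · change (dot _ _ _ _).cost + (1 + 1) = _
        rw [dot_cost]
  rw [h]
  have h2 := sum_upper_linear (-2) 2 2 n
  -- The linear formula counts `2` on the diagonal, where a single division is spent; hence the
  -- correction by `1`.
  have h3 : ((∑ i : Fin n, ∑ j : Fin n,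
      if j < i then 0 else if j = i then 1 else 2 * (idxIoc i j).length + 2 : ℕ) : ℤ) =
      ∑ i : Fin n, ∑ j : Fin n, ((if i ≤ j then (-2) * (i : ℤ) + 2 * (j : ℤ) + 2 else 0)
        - if i = j then 1 else 0) := by
    push_cast
    refine Finset.sum_congr rfl fun i _ => Finset.sum_congr rfl fun j _ => ?_
    rcases lt_trichotomy i j with h | rfl | h
    · rw [if_neg h.not_gt, if_neg h.ne', if_pos h.le, if_neg h.ne, length_idxIoc h.le]; ring
    · simp
    · rw [if_pos h, if_neg h.not_ge, if_neg h.ne', sub_zero]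
  rw [h3]
  simp only [Finset.sum_sub_distrib, Finset.sum_ite_eq, Finset.mem_univ, if_true,
    Finset.sum_const, Finset.card_univ, Fintype.card_fin, mul_sub]
  rw [h2]
  simp

theorem normInf_cost (M : FMat fmt n) : (normInf M).cost = n * n + n := by
  have h : (normInf M).cost = (∑ i, ((allIdx n).foldlM (fun acc j => fadd .up acc (M i j))
      (Fl.zero false)).cost) + ((allIdx n).foldlM (fun acc i => fmax acc
        ((allIdx n).foldlM (fun acc j => fadd .up acc (M i j)) (Fl.zero false)).val)
        (Fl.zero false)).cost := rfl
  rw [h]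
  rw [foldlM_cost _ _ (fun _ => 1) (fun _ _ => rfl)]
  simp only [foldlM_cost _ (fun acc j => fadd .up acc (M _ j)) (fun _ => 1) (fun _ _ => rfl)]
  simp [length_allIdx]

theorem gramBound_cost {range : Fin n → List (Fin n)} {lo hi : FMat fmt n} (a b : ℤ)
    (h : ∀ i, ((range i).length : ℤ) = a * i + b) :
    6 * ((gramBound range lo hi).cost : ℤ) =
      30 * n ^ 2 + 8 * a * ((n - 1) * n * (n + 1)) + 3 * (8 * b + 7) * (n * (n + 1)) := by
  have hd : ∀ (m : Mode) (u v : Fin n → Fin n → Fin n → Fl fmt),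
      6 * ((upper fun i j => dot m (range i) (u i j) (v i j)).cost : ℤ) =
        2 * a * ((n - 1) * n * (n + 1)) + 3 * (2 * b) * (n * (n + 1)) := fun m u v => by
    have := upper_cost_linear (f := fun i j => dot m (range i) (u i j) (v i j)) (2 * a) 0 (2 * b)
      (fun i j _ => by rw [dot_cost]; push_cast; rw [h]; ring)
    rw [this]; ring
  have hs : ∀ dn up P Q : FMat fmt n, 6 * ((symmetric fun i j => do
      let c ← absSub (dn i j) (up i j) (scalarEntry Fl.one i j)
      let s ← fadd .up c (P i j)
      fadd .up s (Q i j)).cost : ℤ) = 21 * (n * (n + 1)) := fun dn up P Q => by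
    rw [symmetric_cost, upper_cost_linear 0 0 7 (fun i j _ => by
      change ((7 : ℕ) : ℤ) = _
      push_cast; ring)]; ring
  refine (bind_cost (matrix_cost_const (c := 2) fun _ _ => rfl) fun mid =>
    bind_cost (matrix_cost_const (c := 1) fun _ _ => rfl) fun rad =>
    bind_cost (matrix_cost_const (c := 1) fun _ _ => rfl) fun amid =>
    bind_cost (matrix_cost_const (c := 1) fun _ _ => rfl) fun sup =>
    bind_cost (hd _ _ _) fun dn => bind_cost (hd _ _ _) fun up =>
    bind_cost (hd _ _ _) fun P => bind_cost (hd _ _ _) fun Q => hs dn up P Q).trans ?_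
  push_cast; ring

/-- Cubic terms, in units of `n³`: `1/3` for `V`, `2/3` for the enclosure of `W`, `4/3` for its Gram
bound, `2` for the enclosure of `B`, `4` for its Gram bound, `1` for `T`, `1/3` for `G` and `1/3`
for `F`. They add up to `10`. -/
theorem errorBound_cost (mode : Mode) (A R : FMat fmt n) :
    6 * ((errorBound mode A R).cost : ℤ) =
      60 * n ^ 3 + 252 * n ^ 2 + 126 * n + 72 := by
  have hIcc : ∀ (m : Mode) (u v : Fin n → Fin n → Fin n → Fl fmt),
      6 * ((upper fun i j => dot m (idxIcc i j) (u i j) (v i j)).cost : ℤ) =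
        2 * ((n - 1) * n * (n + 1)) + 6 * (n * (n + 1)) := fun m u v => by
    have := upper_cost_linear (f := fun i j => dot m (idxIcc i j) (u i j) (v i j)) (-2) 2 2
      (fun i j h => by rw [dot_cost]; push_cast; rw [length_idxIcc h]; ring)
    rw [this]; ring
  have hmat : ∀ (m : Mode) (u v : Fin n → Fin n → Fin n → Fl fmt),
      6 * ((matrix fun i j => dot m (idxLE j) (u i j) (v i j)).cost : ℤ) =
        6 * n ^ 2 * (n + 1) := fun m u v => by
    change 6 * ((∑ i : Fin n, ∑ j : Fin n, (dot m (idxLE j) (u i j) (v i j)).cost : ℕ) : ℤ) = _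
    have hG : ∀ k : ℕ, ∑ j : Fin k, (2 * ((j : ℤ) + 1)) = k * (k + 1) := fun k => by
      induction k with
      | zero => simp
      | succ k ih =>
        rw [Fin.sum_univ_castSucc]
        simp only [Fin.val_castSucc, Fin.val_last, ih]
        push_cast; ring
    push_cast
    simp only [dot_cost, Nat.cast_mul, length_idxLE, Nat.cast_ofNat, hG, Finset.sum_const,
      Finset.card_univ, Fintype.card_fin, nsmul_eq_mul]
    ring
  have habs : ∀ (lo hi c : Fin n → Fin n → Fl fmt),
      6 * ((upper fun i j => absSub (lo i j) (hi i j) (c i j)).cost : ℤ) = 15 * (n * (n + 1)) :=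
    fun lo hi c => by
      rw [upper_cost_linear 0 0 5 (fun i j _ => by
        change ((5 : ℕ) : ℤ) = _
        push_cast; ring)]; ring
  have hU : ∀ (lo hi : FMat fmt n) (c : Fl fmt), 6 * ((upper fun i j => do
      let d ← absSub (lo i j) (hi i j) (scalarEntry Fl.two i j)
      fadd .up d c).cost : ℤ) = 18 * (n * (n + 1)) := fun lo hi c => by
    rw [upper_cost_linear 0 0 6 (fun i j _ => by
      change ((6 : ℕ) : ℤ) = _
      push_cast; ring)]; ring
  have hadd : ∀ u v : Fin n → Fin n → Fl fmt,
      6 * ((upper fun i j => fadd .up (u i j) (v i j)).cost : ℤ) = 3 * (n * (n + 1)) :=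
    fun u v => by
      rw [upper_cost_linear 0 0 1 (fun i j _ => by
        change ((1 : ℕ) : ℤ) = _
        push_cast; ring)]; ring
  have hS : ∀ u v : Fin n → Fin n → Fl fmt,
      6 * ((symmetric fun i j => fadd .up (u i j) (v i j)).cost : ℤ) = 3 * (n * (n + 1)) := hadd
  have hfabs : ∀ u : FMat fmt n,
      6 * ((upper fun i j => fabs (u i j)).cost : ℤ) = 3 * (n * (n + 1)) :=
    fun u => by
      rw [upper_cost_linear 0 0 1 (fun i j _ => by
        change ((1 : ℕ) : ℤ) = _
        push_cast; ring)]; ring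
  have hLE : ∀ (m : Mode) (u v : Fin n → Fin n → Fin n → Fl fmt),
      6 * ((symmetric fun i j => dot m (idxLE i) (u i j) (v i j)).cost : ℤ) =
        2 * ((n - 1) * n * (n + 1)) + 6 * (n * (n + 1)) := fun m u v => by
    have := upper_cost_linear (f := fun i j => dot m (idxLE i) (u i j) (v i j)) 2 0 2
      (fun i j h => by rw [dot_cost]; push_cast; rw [length_idxLE]; ring)
    rw [symmetric_cost, this]; ring
  have hnorm : ∀ M : FMat fmt n, 6 * ((normInf M).cost : ℤ) = 6 * (n * n + n) := fun M => by
    rw [normInf_cost]; push_cast; ring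
  have htail : ∀ g : Fl fmt, 6 * ((tailBound g).cost : ℤ) = 30 := fun g => rfl
  have hflt : ∀ a b : Fl fmt, 6 * ((flt a b).cost : ℤ) = 6 := fun a b => rfl
  unfold errorBound
  refine (bind_cost (triInverse_cost mode R) fun V =>
    bind_cost (hIcc _ _ _) fun Wlo => bind_cost (hIcc _ _ _) fun Whi =>
    bind_cost (habs _ _ _) fun E => bind_cost (hnorm E) fun w => bind_cost (hflt _ _) fun inv =>
    bind_cost (htail w) fun c => bind_cost (hU Wlo Whi c) fun U =>
    bind_cost (gramBound_cost 1 1 fun i => by rw [length_idxLE, one_mul]) fun SW =>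
    bind_cost (hmat _ _ _) fun Blo => bind_cost (hmat _ _ _) fun Bhi =>
    bind_cost (gramBound_cost 0 n fun i => by rw [length_allIdx]; ring) fun SA =>
    bind_cost (hS _ _) fun S => bind_cost (hmat _ _ _) fun T =>
    bind_cost (hLE _ _ _) fun G => bind_cost (hnorm G) fun g => bind_cost (hflt _ _) fun con =>
    bind_cost (htail g) fun h => bind_cost (hadd _ _) fun H => bind_cost (hfabs _) fun absR =>
    bind_cost (hIcc _ _ _) fun F => pure_cost _).trans ?_
  push_cast
  ring_nf

/-! ### Correctness of the algorithm -/

theorem triInverse_lower (mode : Mode) (R : FMat fmt n) (i j : Fin n) (h : j < i) :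
    (triInverse mode R).val i j = Fl.zero false := by
  have key : ∀ (ks : List (Fin n)) (f : FMat fmt n → Fin n → Counted (FMat fmt n)) (V : FMat fmt n),
      (∀ V k, (∀ i j, j < i → V i j = Fl.zero false) →
        ∀ i j, j < i → (f V k).val i j = Fl.zero false) →
      (∀ i j, j < i → V i j = Fl.zero false) →
      ∀ i j, j < i → (ks.foldlM f V).val i j = Fl.zero false := by
    intro ks
    induction ks with
    | nil => exact fun f V _ hV => hV
    | cons k ks ih => exact fun f V hf hV => ih f _ hf (hf V k hV)
  refine key _ _ _ ?_ (fun _ _ _ => rfl) i j h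
  intro V k hV i j hij
  change Function.update V k _ i j = _
  by_cases hik : i = k
  · subst hik
    refine (congrFun (Function.update_self i _ _) j).trans ?_
    change Counted.val (if j < i then _ else _) = _
    rw [if_pos hij]
    rfl
  · exact (congrFun (Function.update_of_ne hik _ _) j).trans (hV i j hij)

/-- The bound by `U` is conditional, since an entry of `U` might not be finite; its finiteness is
only learned from the later test on `g`. -/
theorem inverse_bound {R V Wlo Whi E U : FMat fmt n} {w c : Fl fmt}
    (hRfin : ∀ i j, (R i j).IsFinite) (hRtri : ∀ i j, j < i → (R i j).toReal = 0)
    (hV : ∀ i j, j < i → V i j = Fl.zero false)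
    (hWlo : Wlo = (upper fun i j => dot .down (idxIcc i j) (fun k => R i k) (fun k => V k j)).val)
    (hWhi : Whi = (upper fun i j => dot .up (idxIcc i j) (fun k => R i k) (fun k => V k j)).val)
    (hE : E = (upper fun i j => absSub (Wlo i j) (Whi i j) (scalarEntry Fl.one i j)).val)
    (hw : w = (normInf E).val) (hlt : lt w one = true) (hc : c = (tailBound w).val)
    (hU : U = (upper fun i j => do
      let d ← absSub (Wlo i j) (Whi i j) (scalarEntry Fl.two i j)
      fadd .up d c).val)
    {W : Matrix (Fin n) (Fin n) ℝ} (hW : W = R.map toReal * V.map toReal) :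
    (∀ i j, (V i j).IsFinite) ∧ (∀ i j, (Wlo i j).Below (W i j)) ∧
      (∀ i j, (Whi i j).Above (W i j)) ∧ (∀ i j, j < i → W i j = 0) ∧ IsUnit W.det ∧
      (∀ i j, (U i j).Nonneg) ∧
      ∀ i j, (i ≤ j → (U i j).IsFinite) → |W⁻¹ i j| ≤ (U i j).toReal := by
  have hEn : ∀ i j, (E i j).Nonneg := fun i j => by
    rw [hE, upper_val]
    split_ifs
    · exact nonneg_absSub _ _ _
    · exact nonneg_zero _
  have hwn : w.Nonneg := hw ▸ nonneg_normInf hEn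
  obtain ⟨hwf, hw1⟩ := hwn.lt_one hlt
  have hsum := normInf_spec hEn (hw ▸ hwf)
  rw [← hw] at hsum
  have hEval : ∀ i j, i ≤ j → E i j = (absSub (Wlo i j) (Whi i j) (scalarEntry Fl.one i j)).val :=
    fun i j hij => by rw [hE, upper_val, if_pos hij]
  have hspec : ∀ i j, i ≤ j → _ := fun i j hij => absSub_spec (hEval i j hij ▸ (hsum i).1 j)
  -- The sum for entry `(i, j)` of `Wlo` contains the product `R i i * V i j`, so its finiteness
  -- reaches `V i j`.
  have hVfin : ∀ i j, (V i j).IsFinite := fun i j => by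
    rcases le_or_gt i j with h | h
    · have := (hspec i j h).1
      rw [hWlo, upper_val, if_pos h] at this
      exact (isFinite_of_dot this i (mem_idxIcc.2 ⟨le_rfl, h⟩)).2
    · rw [hV i j h]; trivial
  have hterm : ∀ i j k, k ∉ idxIcc i j → (R i k).toReal * (V k j).toReal = 0 := fun i j k hk => by
    rw [mem_idxIcc, not_and_or, not_le, not_le] at hk
    rcases hk with hk | hk
    · rw [hRtri i k hk, zero_mul]
    · rw [hV k j hk]; exact mul_zero _
  have hWij : ∀ i j, W i j = ∑ k, (R i k).toReal * (V k j).toReal := fun i j => by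
    rw [hW, Matrix.mul_apply]; rfl
  have hWtri : ∀ i j, j < i → W i j = 0 := fun i j h => by
    rw [hWij]
    refine Finset.sum_eq_zero fun k _ => hterm i j k fun hk => ?_
    rw [mem_idxIcc] at hk
    exact absurd (hk.1.trans hk.2) (not_le.2 h)
  have hlo : ∀ i j, (Wlo i j).Below (W i j) := fun i j => by
    rw [hWlo, upper_val]
    split_ifs with h
    · rw [hWij]
      exact below_dot (nodup_idxIcc i j) (fun k _ => ⟨hRfin i k, hVfin k j⟩) (fun _ _ => le_rfl)
        fun k hk => (hterm i j k hk).ge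
    · rw [hWtri i j (not_le.1 h)]; exact below_zero _
  have hhi : ∀ i j, (Whi i j).Above (W i j) := fun i j => by
    rw [hWhi, upper_val]
    split_ifs with h
    · rw [hWij]
      exact above_dot (nodup_idxIcc i j) (fun k _ => ⟨hRfin i k, hVfin k j⟩) (fun _ _ => le_rfl)
        fun k hk => (hterm i j k hk).le
    · rw [hWtri i j (not_le.1 h)]; exact above_zero _
  have hrow : ∀ i, ∑ j, |(W - 1) i j| ≤ w.toReal := fun i => by
    refine le_trans (Finset.sum_le_sum fun j _ => ?_) (hsum i).2
    rcases le_or_gt i j with h | h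
    · obtain ⟨h1, h2, h3⟩ := hspec i j h
      have := h3 (W i j) ((hlo i j).le h1) ((hhi i j).le h2)
      rwa [scalarEntry_toReal, toReal_one, one_smul, ← hEval i j h] at this
    · rw [Matrix.sub_apply, hWtri i j h, Matrix.one_apply_ne h.ne', sub_zero, abs_zero]
      exact (hEn i j).toReal_nonneg
  obtain ⟨hunit, hinv⟩ := abs_inv_le hWtri hw1 hrow
  obtain ⟨hcf, hcl, -⟩ := tailBound_spec hwf hwn.toReal_nonneg hw1
  rw [← hc] at hcf hcl
  have h1w : 0 < 1 - w.toReal := by linarith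
  have hc0 : 0 ≤ c.toReal := le_trans (by positivity) hcl
  have hUval : ∀ i j, i ≤ j →
      U i j = add .up (absSub (Wlo i j) (Whi i j) (scalarEntry Fl.two i j)).val c :=
    fun i j h => by rw [hU, upper_val, if_pos h]; rfl
  have hUn : ∀ i j, (U i j).Nonneg := fun i j => by
    rcases le_or_gt i j with h | h
    · rw [hUval i j h]
      exact (nonneg_absSub _ _ _).add (Or.inr (Or.inr ⟨hcf, hc0⟩))
    · rw [hU, upper_val, if_neg (not_le.2 h)]; exact nonneg_zero _
  refine ⟨hVfin, hlo, hhi, hWtri, hunit, hUn, fun i j hf => ?_⟩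
  rcases le_or_gt i j with h | h
  · have hf := hf h
    rw [hUval i j h] at hf ⊢
    have h1 := add_up_ge hf
    obtain ⟨-, -, h3⟩ := absSub_spec (isFinite_of_add hf).1
    obtain ⟨h4, h5, -⟩ := hspec i j h
    have h6 := h3 (W i j) ((hlo i j).le h4) ((hhi i j).le h5)
    rw [scalarEntry_toReal, toReal_two, abs_sub_comm] at h6
    have := hinv i j
    rw [Matrix.sub_apply] at this
    linarith
  · rw [inv_upper hWtri hunit h, abs_zero]
    exact (hUn i j).toReal_nonneg

/-- Rests on `BᵀB - WᵀW = (BᵀB - 1) - (WᵀW - 1)`: both Gram matrices are compared with the identity.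
The test on `g` certifies, in turn, `G`, the upper triangles of `U` and `T`, and all of `S`. -/
theorem residual_bound {A V Wlo Whi U SW Blo Bhi SA S T G : FMat fmt n} {g : Fl fmt}
    {W B : Matrix (Fin n) (Fin n) ℝ}
    (hAfin : ∀ i j, (A i j).IsFinite) (hVfin : ∀ i j, (V i j).IsFinite)
    (hV : ∀ i j, j < i → V i j = Fl.zero false)
    (hlo : ∀ i j, (Wlo i j).Below (W i j)) (hhi : ∀ i j, (Whi i j).Above (W i j))
    (hWtri : ∀ i j, j < i → W i j = 0) (hUn : ∀ i j, (U i j).Nonneg)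
    (hSW : SW = (gramBound idxLE Wlo Whi).val)
    (hBlo : Blo = (matrix fun i j => dot .down (idxLE j) (fun k => A i k) (fun k => V k j)).val)
    (hBhi : Bhi = (matrix fun i j => dot .up (idxLE j) (fun k => A i k) (fun k => V k j)).val)
    (hSA : SA = (gramBound (fun _ => allIdx n) Blo Bhi).val)
    (hS : S = (symmetric fun i j => fadd .up (SA i j) (SW i j)).val)
    (hT : T = (matrix fun i j => dot .up (idxLE j) (fun k => S i k) (fun k => U k j)).val)
    (hG : G = (symmetric fun i j => dot .up (idxLE i) (fun k => U k i) (fun k => T k j)).val)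
    (hg : g = (normInf G).val) (hlt : lt g one = true)
    (hB : B = A.map toReal * V.map toReal) :
    g.IsFinite ∧ g.toReal < 1 ∧ (∀ i j, (G i j).IsFinite ∧ 0 ≤ (G i j).toReal) ∧
      (∀ i j, G i j = G j i) ∧ (∀ i, ∑ j, (G i j).toReal ≤ g.toReal) ∧
      ∀ X : Matrix (Fin n) (Fin n) ℝ, (∀ i j, j < i → X i j = 0) →
        (∀ i j, (i ≤ j → (U i j).IsFinite) → |X i j| ≤ (U i j).toReal) →
        ∀ i j, |(X.transpose * ((B.transpose * B - W.transpose * W) * X)) i j|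
          ≤ (G i j).toReal := by
  have hBij : ∀ i j, B i j = ∑ k, (A i k).toReal * (V k j).toReal := fun i j => by
    rw [hB, Matrix.mul_apply]; rfl
  have hterm : ∀ i j k, k ∉ idxLE j → (A i k).toReal * (V k j).toReal = 0 := fun i j k hk => by
    rw [mem_idxLE, not_le] at hk
    rw [hV k j hk]; exact mul_zero _
  have hBl : ∀ i j, (Blo i j).Below (B i j) := fun i j => by
    rw [hBlo, hBij, matrix_val]
    exact below_dot (nodup_idxLE j) (fun k _ => ⟨hAfin i k, hVfin k j⟩) (fun _ _ => le_rfl)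
      fun k hk => (hterm i j k hk).ge
  have hBh : ∀ i j, (Bhi i j).Above (B i j) := fun i j => by
    rw [hBhi, hBij, matrix_val]
    exact above_dot (nodup_idxLE j) (fun k _ => ⟨hAfin i k, hVfin k j⟩) (fun _ _ => le_rfl)
      fun k hk => (hterm i j k hk).le
  have hSWn : ∀ i j, (SW i j).Nonneg := hSW ▸ nonneg_gramBound hlo hhi
  have hSAn : ∀ i j, (SA i j).Nonneg := hSA ▸ nonneg_gramBound hBl hBh
  have hSWc : ∀ i j, SW i j = SW j i := hSW ▸ gramBound_comm _ _ _
  have hSAc : ∀ i j, SA i j = SA j i := hSA ▸ gramBound_comm _ _ _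
  have hSij : ∀ i j, S i j = add .up (SA i j) (SW i j) := fun i j => by
    rw [hS, symmetric_val]
    split_ifs
    · rfl
    · rw [hSAc i j, hSWc i j]; rfl
  have hTij : ∀ i j, T i j = (dot .up (idxLE j) (fun k => S i k) (fun k => U k j)).val :=
    fun i j => by rw [hT]; rfl
  have hGij : ∀ i j, i ≤ j →
      G i j = (dot .up (idxLE i) (fun k => U k i) (fun k => T k j)).val :=
    fun i j h => by rw [hG, symmetric_val, if_pos h]
  have hGc : ∀ i j, G i j = G j i := fun i j => by
    rw [hG, symmetric_val, symmetric_val]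
    rcases lt_trichotomy i j with h | rfl | h
    · rw [if_pos h.le, if_neg (not_le.2 h)]
    · rfl
    · rw [if_pos h.le, if_neg (not_le.2 h)]
  have hSn : ∀ i j, (S i j).Nonneg := fun i j => hSij i j ▸ (hSAn i j).add (hSWn i j)
  have hTn : ∀ i j, (T i j).Nonneg := fun i j => by
    rw [hTij]; exact nonneg_dot fun k _ => ⟨hSn i k, hUn k j⟩
  have hGn' : ∀ i j, i ≤ j → (G i j).Nonneg := fun i j h => by
    rw [hGij i j h]; exact nonneg_dot fun k _ => ⟨hUn k i, hTn k j⟩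
  have hGn : ∀ i j, (G i j).Nonneg := fun i j => by
    rcases le_total i j with h | h
    · exact hGn' i j h
    · rw [hGc]; exact hGn' j i h
  have hgn : g.Nonneg := hg ▸ nonneg_normInf hGn
  obtain ⟨hgf, hg1⟩ := hgn.lt_one hlt
  have hsum := normInf_spec hGn (hg ▸ hgf)
  rw [← hg] at hsum
  have hGf : ∀ i j, (G i j).IsFinite := fun i => (hsum i).1
  have hUT : ∀ k j, k ≤ j → (U k j).IsFinite ∧ (T k j).IsFinite := fun k j h => by
    have := hGf j j
    rw [hGij j j le_rfl] at this
    exact isFinite_of_dot this k (mem_idxLE.2 h)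
  -- Column `k ⊔ l` of `T` is the choice for which row `k` lies in the certified triangle and index
  -- `l` in the range of its sum.
  have hSf : ∀ k l, (S k l).IsFinite := fun k l => by
    have := (hUT k (k ⊔ l) le_sup_left).2
    rw [hTij] at this
    exact (isFinite_of_dot this l (mem_idxLE.2 le_sup_right)).1
  have hSS : ∀ i j, (SA i j).IsFinite ∧ (SW i j).IsFinite := fun i j =>
    isFinite_of_add (hSij i j ▸ hSf i j)
  have hSAle : ∀ i j, |(B.transpose * B - 1) i j| ≤ (SA i j).toReal := fun i j => by
    have := gramBound_spec hBl hBh (fun _ => nodup_allIdx n)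
      (fun i k hk => absurd (mem_allIdx k) hk) (fun i j => by rw [← hSA]; exact (hSS i j).1) i j
    rwa [← hSA] at this
  have hSWle : ∀ i j, |(W.transpose * W - 1) i j| ≤ (SW i j).toReal := fun i j => by
    have := gramBound_spec hlo hhi nodup_idxLE
      (fun i k hk => hWtri k i (by rwa [mem_idxLE, not_le] at hk))
      (fun i j => by rw [← hSW]; exact (hSS i j).2) i j
    rwa [← hSW] at this
  set K := B.transpose * B - W.transpose * W with hK
  have hKle : ∀ i j, |K i j| ≤ (S i j).toReal := fun i j => by
    have h1 : K i j = (B.transpose * B - 1) i j - (W.transpose * W - 1) i j := by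
      simp only [hK, Matrix.sub_apply]; ring
    have h2 := hSf i j
    have h3 := hSAle i j
    have h4 := hSWle i j
    rw [hSij] at h2 ⊢
    have h5 := add_up_ge h2
    rw [h1]
    exact (abs_sub _ _).trans (by linarith)
  have hKt : K.transpose = K := by
    simp [hK, Matrix.transpose_sub, Matrix.transpose_mul]
  refine ⟨hgf, hg1, fun i j => ⟨hGf i j, (hGn i j).toReal_nonneg⟩, hGc, fun i => (hsum i).2, ?_⟩
  intro X hX hXU
  have hXle : ∀ i j, |X i j| ≤ (U i j).toReal := fun i j => hXU i j fun h => (hUT i j h).1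
  have hTle : ∀ k j, k ≤ j → |(K * X) k j| ≤ (T k j).toReal := fun k j h => by
    have hf := (hUT k j h).2
    rw [hTij] at hf ⊢
    refine (abs_mul_apply_le _ _ _ _).trans (le_dot_up (nodup_idxLE j) hf (fun l _ => ?_) ?_)
    · exact mul_le_mul (hKle k l) (hXle l j) (abs_nonneg _) ((abs_nonneg _).trans (hKle k l))
    · intro l hl
      rw [mem_idxLE, not_le] at hl
      rw [hX l j hl, abs_zero, mul_zero]
  have hle : ∀ i j, i ≤ j → |(X.transpose * (K * X)) i j| ≤ (G i j).toReal := fun i j h => by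
    have hf := hGf i j
    rw [hGij i j h] at hf ⊢
    refine (abs_mul_apply_le _ _ _ _).trans (le_dot_up (nodup_idxLE i) hf (fun k hk => ?_) ?_)
    · rw [mem_idxLE] at hk
      exact mul_le_mul (hXle k i) (hTle k j (hk.trans h)) (abs_nonneg _)
        ((abs_nonneg _).trans (hXle k i))
    · intro k hk
      rw [mem_idxLE, not_le] at hk
      rw [Matrix.transpose_apply, hX k i hk, abs_zero, zero_mul]
  intro i j
  rcases le_total i j with h | h
  · exact hle i j h
  -- Only the upper triangle was computed from `T`; the lower one follows from the symmetry of `K`.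
  · have e : (X.transpose * (K * X)).transpose = X.transpose * (K * X) := by
      rw [Matrix.transpose_mul, Matrix.transpose_mul, Matrix.transpose_transpose, hKt,
        Matrix.mul_assoc]
    rw [← e, Matrix.transpose_apply, hGc i j]
    exact hle j i h

/-- The conclusion is `Above`, not a bound under finiteness: no test follows, so NaN has to be
excluded here, by showing that `H` is finite. -/
theorem above_product {R H absR F G : FMat fmt n} {g h : Fl fmt}
    {C : Matrix (Fin n) (Fin n) ℝ}
    (hRfin : ∀ i j, (R i j).IsFinite) (hRtri : ∀ i j, j < i → (R i j).toReal = 0)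
    (hCtri : ∀ i j, j < i → (C - 1) i j = 0)
    (hC : ∀ i j, i ≤ j → |(C - 1) i j| ≤ (G i j).toReal + g.toReal ^ 2 / (1 - g.toReal))
    (hgf : g.IsFinite) (hg0 : 0 ≤ g.toReal) (hg1 : g.toReal < 1)
    (hGf : ∀ i j, (G i j).IsFinite) (hGg : ∀ i j, (G i j).toReal ≤ g.toReal)
    (hh : h = (tailBound g).val)
    (hH : H = (upper fun i j => fadd .up (G i j) h).val)
    (habs : absR = (upper fun i j => fabs (R i j)).val)
    (hF : F = (upper fun i j => dot .up (idxIcc i j) (fun k => H i k) (fun k => absR k j)).val)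
    (i j : Fin n) : (F i j).Above |((C - 1) * R.map toReal) i j| := by
  obtain ⟨hhf, hhl, hhu⟩ := tailBound_spec hgf hg0 hg1
  rw [← hh] at hhf hhl hhu
  have hHij : ∀ i j, i ≤ j → H i j = add .up (G i j) h := fun i j hij => by
    rw [hH, upper_val, if_pos hij]; rfl
  -- The exact sum is at most `1 + 2 ^ prec`, below a representable number.
  have hHf : ∀ i j, i ≤ j → (H i j).IsFinite := fun i j hij => by
    obtain ⟨s, hs⟩ := add_up_eq (hGf i j) hhf
    obtain ⟨y, hy, hle⟩ := fmt.exists_rep_ge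
    rw [hHij i j hij, hs]
    exact (roundUp_le_rep s hy (by linarith [hGg i j])).1
  have hHle : ∀ i j, i ≤ j → |(C - 1) i j| ≤ (H i j).toReal := fun i j hij => by
    have hf := hHf i j hij
    rw [hHij i j hij] at hf ⊢
    linarith [add_up_ge hf, hC i j hij]
  have hRij : ∀ i j, i ≤ j → absR i j = Fl.abs (R i j) := fun i j hij => by
    rw [habs, upper_val, if_pos hij]; rfl
  have hout : ∀ k, k ∉ idxIcc i j → |(C - 1) i k| * |(R.map toReal) k j| ≤ 0 := fun k hk => by
    rw [mem_idxIcc, not_and_or, not_le, not_le] at hk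
    rcases hk with hk | hk
    · rw [hCtri i k hk, abs_zero, zero_mul]
    · rw [Matrix.map_apply, hRtri k j hk, abs_zero, mul_zero]
  rw [hF, upper_val]
  split_ifs with hij
  · refine (above_dot (nodup_idxIcc i j) (g := fun k => |(C - 1) i k| * |(R.map toReal) k j|)
      (fun k hk => ?_) (fun k hk => ?_) hout).mono (abs_mul_apply_le _ _ _ _)
    · rw [mem_idxIcc] at hk
      rw [hRij k j hk.2]
      exact ⟨hHf i k hk.1, isFinite_abs.2 (hRfin k j)⟩
    · rw [mem_idxIcc] at hk
      rw [hRij k j hk.2, toReal_abs]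
      exact mul_le_mul_of_nonneg_right (hHle i k hk.1) (abs_nonneg _)
  · refine (above_zero _).mono ((abs_mul_apply_le _ _ _ _).trans
      (Finset.sum_nonpos fun k _ => hout k fun hk => ?_))
    rw [mem_idxIcc] at hk
    exact hij (hk.1.trans hk.2)

theorem errorBound_bounds (mode : Mode) {A R' : FMat fmt n}
    (hA : ∀ i j, (A i j).IsFinite) (hR' : ∀ i j, (R' i j).IsFinite)
    (htri : ∀ i j, j < i → (R' i j).toReal = 0) (hdiag : ∀ i, 0 ≤ (R' i i).toReal)
    {R : Matrix (Fin n) (Fin n) ℝ} (hR : IsQRFactor (A.map toReal) R) (i j : Fin n) :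
    ((errorBound mode A R').val i j).Bounds |(R' i j).toReal - R i j| := by
  obtain ⟨V, hVdef⟩ : ∃ V, V = (triInverse mode R').val := ⟨_, rfl⟩
  obtain ⟨Wlo, hWlo⟩ : ∃ M, M = (upper fun i j =>
    dot .down (idxIcc i j) (fun k => R' i k) (fun k => V k j)).val := ⟨_, rfl⟩
  obtain ⟨Whi, hWhi⟩ : ∃ M, M = (upper fun i j =>
    dot .up (idxIcc i j) (fun k => R' i k) (fun k => V k j)).val := ⟨_, rfl⟩
  obtain ⟨E, hE⟩ : ∃ M, M = (upper fun i j =>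
    absSub (Wlo i j) (Whi i j) (scalarEntry Fl.one i j)).val := ⟨_, rfl⟩
  obtain ⟨w, hw⟩ : ∃ x, x = (normInf E).val := ⟨_, rfl⟩
  obtain ⟨c, hc⟩ : ∃ x, x = (tailBound w).val := ⟨_, rfl⟩
  obtain ⟨U, hU⟩ : ∃ M, M = (upper fun i j => do
    let d ← absSub (Wlo i j) (Whi i j) (scalarEntry Fl.two i j)
    fadd .up d c).val := ⟨_, rfl⟩
  obtain ⟨SW, hSW⟩ : ∃ M, M = (gramBound idxLE Wlo Whi).val := ⟨_, rfl⟩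
  obtain ⟨Blo, hBlo⟩ : ∃ M, M = (matrix fun i j =>
    dot .down (idxLE j) (fun k => A i k) (fun k => V k j)).val := ⟨_, rfl⟩
  obtain ⟨Bhi, hBhi⟩ : ∃ M, M = (matrix fun i j =>
    dot .up (idxLE j) (fun k => A i k) (fun k => V k j)).val := ⟨_, rfl⟩
  obtain ⟨SA, hSA⟩ : ∃ M, M = (gramBound (fun _ => allIdx n) Blo Bhi).val := ⟨_, rfl⟩
  obtain ⟨S, hS⟩ : ∃ M, M = (symmetric fun i j => fadd .up (SA i j) (SW i j)).val := ⟨_, rfl⟩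
  obtain ⟨T, hT⟩ : ∃ M, M = (matrix fun i j =>
    dot .up (idxLE j) (fun k => S i k) (fun k => U k j)).val := ⟨_, rfl⟩
  obtain ⟨G, hG⟩ : ∃ M, M = (symmetric fun i j =>
    dot .up (idxLE i) (fun k => U k i) (fun k => T k j)).val := ⟨_, rfl⟩
  obtain ⟨g, hg⟩ : ∃ x, x = (normInf G).val := ⟨_, rfl⟩
  obtain ⟨h, hh⟩ : ∃ x, x = (tailBound g).val := ⟨_, rfl⟩
  obtain ⟨H, hH⟩ : ∃ M, M = (upper fun i j => fadd .up (G i j) h).val := ⟨_, rfl⟩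
  obtain ⟨absR, habs⟩ : ∃ M, M = (upper fun i j => fabs (R' i j)).val := ⟨_, rfl⟩
  obtain ⟨F, hF⟩ : ∃ M, M = (upper fun i j =>
    dot .up (idxIcc i j) (fun k => H i k) (fun k => absR k j)).val := ⟨_, rfl⟩
  have hval : (errorBound mode A R').val =
      (if lt w one && lt g one then F else fun _ _ => Fl.inf false : FMat fmt n) := by
    subst hVdef hWlo hWhi hE hw hc hU hSW hBlo hBhi hSA hS hT hG hg hh hH habs hF
    rfl
  by_cases htest : (lt w one && lt g one) = true
  swap
  -- A failed test returns `+∞`, which bounds everything.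
  · rw [congrFun (congrFun (hval.trans (if_neg htest)) i) j]
    rfl
  rw [congrFun (congrFun (hval.trans (if_pos htest)) i) j]
  rw [Bool.and_eq_true] at htest
  have hV : ∀ i j, j < i → V i j = Fl.zero false := hVdef ▸ triInverse_lower mode R'
  obtain ⟨hVfin, hlo, hhi, hWtri, hunit, hUn, hUle⟩ :=
    inverse_bound hR' htri hV hWlo hWhi hE hw htest.1 hc hU rfl
  obtain ⟨hgf, hg1, hGf, hGc, hrow, hres⟩ :=
    residual_bound hA hVfin hV hlo hhi hWtri hUn hSW hBlo hBhi hSA hS hT hG hg htest.2 rfl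
  set Rr : Matrix (Fin n) (Fin n) ℝ := R'.map toReal with hRr
  set Vr : Matrix (Fin n) (Fin n) ℝ := V.map toReal
  set Ar : Matrix (Fin n) (Fin n) ℝ := A.map toReal
  have hWW : Rr * Vr * (Rr * Vr)⁻¹ = 1 := Matrix.mul_nonsing_inv _ hunit
  have hRinv : Rr * (Vr * (Rr * Vr)⁻¹) = 1 := by rw [← Matrix.mul_assoc, hWW]
  have hRinv' : Vr * (Rr * Vr)⁻¹ * Rr = 1 := mul_eq_one_comm.1 hRinv
  have hRdet : IsUnit Rr.det := Matrix.isUnit_det_of_right_inverse hRinv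
  have hRtri : ∀ i j, j < i → Rr i j = 0 := htri
  -- Invertibility upgrades the nonnegative diagonal to a positive one, which `C` needs for its own
  -- positive diagonal.
  have hRpos : ∀ i, 0 < Rr i i := fun i => by
    refine lt_of_le_of_ne (hdiag i) fun h0 => ?_
    refine hRdet.ne_zero ?_
    rw [Matrix.det_of_isUpperTriangular (fun i j h => hRtri i j h)]
    exact Finset.prod_eq_zero (Finset.mem_univ i) h0.symm
  obtain ⟨hRt, hRd, Q, hQ, hAQ⟩ := hR
  set X := (Rr * Vr)⁻¹ with hX
  set C := R * (Vr * X) with hC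
  have hCR : C * Rr = R := by rw [hC, Matrix.mul_assoc, hRinv', Matrix.mul_one]
  have hCtri : ∀ i j, j < i → C i j = 0 := by
    have hinv : Rr⁻¹ = Vr * X := Matrix.inv_eq_right_inv hRinv
    intro i j hij
    rw [hC, ← hinv, Matrix.mul_apply]
    refine Finset.sum_eq_zero fun k _ => ?_
    rcases lt_or_ge k i with hk | hk
    · rw [hRt i k hk, zero_mul]
    · rw [inv_upper hRtri hRdet (hij.trans_le hk), mul_zero]
  have hCpos : ∀ i, 0 < C i i := fun i => by
    have h1 : R i i = C i i * Rr i i := by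
      conv_lhs => rw [← hCR, Matrix.mul_apply]
      refine Finset.sum_eq_single i (fun k _ hk => ?_) (by simp)
      rcases lt_or_gt_of_ne hk with hk | hk
      · rw [hCtri i k hk, zero_mul]
      · rw [hRtri k i hk, mul_zero]
    exact pos_of_mul_pos_left (h1 ▸ hRd i) (hRpos i).le
  -- Here `A V X = Q C`, so the left side is the Gram matrix of `A V X`, while that of `R' V X = 1`
  -- is the identity.
  have hCC : C.transpose * C = 1 + X.transpose * (((Ar * Vr).transpose * (Ar * Vr)
      - (Rr * Vr).transpose * (Rr * Vr)) * X) := by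
    have hQQ : Q.transpose * Q = 1 := (Matrix.mem_orthogonalGroup_iff' _ _).1 hQ
    have h1 : (Ar * Vr * X).transpose * (Ar * Vr * X) = C.transpose * C := by
      have : Ar * Vr * X = Q * C := by rw [hC, hAQ]; simp only [Matrix.mul_assoc]
      rw [this, Matrix.transpose_mul, Matrix.mul_assoc, ← Matrix.mul_assoc Q.transpose, hQQ,
        Matrix.one_mul]
    have h2 : (Rr * Vr * X).transpose * (Rr * Vr * X) = 1 := by
      rw [hWW, Matrix.transpose_one, Matrix.one_mul]
    rw [← h1, Matrix.sub_mul, Matrix.mul_sub]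
    have h3 : ∀ M : Matrix (Fin n) (Fin n) ℝ,
        X.transpose * (M.transpose * M * X) = (M * X).transpose * (M * X) := fun M => by
      rw [Matrix.transpose_mul]; simp only [Matrix.mul_assoc]
    rw [h3, h3, h2]
    abel
  have hXlow : ∀ i j, j < i → X i j = 0 := fun i j hij => inv_upper hWtri hunit hij
  have hGg : ∀ i j, (G i j).toReal ≤ g.toReal := fun i j =>
    (Finset.single_le_sum (f := fun j => (G i j).toReal) (fun k _ => (hGf i k).2)
      (Finset.mem_univ j)).trans (hrow i)
  have hbound := abs_cholesky_sub_one_le hCtri hCpos hCC (G := fun i j => (G i j).toReal)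
    (hres X hXlow hUle) (fun i j => by rw [hGc]) hg1 hrow
  have hfin := above_product hR' htri (C := C) (fun i j hij => by
    rw [Matrix.sub_apply, hCtri i j hij, Matrix.one_apply_ne hij.ne', sub_zero]) hbound hgf
    ((hGf i j).2.trans (hGg i j)) hg1 (fun i j => (hGf i j).1) hGg hh hH habs hF i j
  have e : |(R' i j).toReal - R i j| = |((C - 1) * R'.map toReal) i j| := by
    rw [← hRr, Matrix.sub_mul, hCR, Matrix.one_mul, Matrix.sub_apply, abs_sub_comm]
    rfl
  rw [e]
  exact hfin.bounds

end CertQR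

theorem theorem3 :
    ∃ C : ℕ, ∀ (fmt : CertQR.Format) (mode : CertQR.Mode) (n : ℕ) (_hn : 0 < n)
      (A R' : CertQR.FMat fmt n)
      (_hA : ∀ i j, (A i j).IsFinite) (_hR' : ∀ i j, (R' i j).IsFinite)
      (_htri : ∀ i j, j < i → (R' i j).toReal = 0)
      (_hdiag : ∀ i, 0 ≤ (R' i i).toReal),
      (∀ R : Matrix (Fin n) (Fin n) ℝ,
        CertQR.IsQRFactor (A.map CertQR.Fl.toReal) R →
          ∀ i j, ((CertQR.errorBound mode A R').val i j).Bounds |(R' i j).toReal - R i j|) ∧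
      |((CertQR.errorBound mode A R').cost : ℤ) - 10 * (n : ℤ) ^ 3| ≤ (C : ℤ) * (n : ℤ) ^ 2 := by
  -- The exact count is `10 n³ + 42 n² + 21 n + 12`, and `42 + 21 + 12 = 75` suffices because `n ≥
  -- 1`.
  refine ⟨75, fun fmt mode n hn A R' hA hR' htri hdiag =>
    ⟨fun R hR i j => CertQR.errorBound_bounds mode hA hR' htri hdiag hR i j, ?_⟩⟩
  have h := CertQR.errorBound_cost mode A R'
  have hn' : (1 : ℤ) ≤ n := by exact_mod_cast hn
  rw [abs_le]
  constructor <;> push_cast <;> nlinarith
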